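/- Let $N\ge 1$, let $M=(m_{ij})$ be an irreducible $N\times N$ stochastic matrix ($m_{ij}$ being the probability of a transition from $i$ to $j$), and let $\varepsilon=(\varepsilon_1,\dots,\varepsilon_N)$ be its equilibrium distribution, i.e. the probability vector with $\varepsilon M=\varepsilon$. Let $\phi^{(1)},\dots,\phi^{(N)}$ be probability laws on $(0,\infty)$ (waiting-time distributions) of asymptotic power-law type: for each $i$ there are an exponent $0<\alpha_i<1$ and a constant $B_{\alpha_i}>0$ with $$\int_0^\infty e^{-s\tau}\,\phi^{(i)}(d\tau)=1-B_{\alpha_i}s^{\alpha_i}+o(s^{\alpha_i})\qquad(s\to0^+).$$ Consider the renewal process with $N$ internal states: the successive internal states $J_0,J_1,J_2,\dots$ form a Markov chain with an arbitrary initial distribution and transition matrix $M$; given this chain, the waiting times $T_0,T_1,\dots$ are independent and $T_n$ has law $\phi^{(J_n)}$. The internal state at time $\tau$ is $i(\tau)=J_n$ if $T_0+\dots+T_{n-1}\le\tau<T_0+\dots+T_n$. Let $t^{(1)}=\int_0^t \mathbf 1_{\{i(\tau)=1\}}\,d\tau$ be the occupation time of state $1$ up to time $t>0$. Then the law $l_{t^{(1)}/t}$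 of the fraction $t^{(1)}/t$ of the time spent in state $1$ converges weakly as $t\to\infty$, as follows. 1. If $\alpha_1<\alpha_j$ for all $j\ne1$, the limit is $\delta(x-1)$, the unit mass at $1$. 2. If $\alpha_j<\alpha_1$ for some $j$, the limit is $\delta(x)$, the unit mass at $0$. 3. Let $2\le m\le N$, $\alpha_1=\dots=\alpha_m=\alpha$, $\alpha_j>\alpha$ for all $j>m$, and suppose that the states $1,\dots,m$ also have the same constant $B_\alpha$. Then the limit is the probability law on $(0,1)$ with density $$\frac{\sin(\pi\alpha)}{\pi}\,\frac{\varepsilon_1(\varepsilon_2+\dots+\varepsilon_m)(1-x)^{\alpha-1}x^{\alpha-1}}{(\varepsilon_2+\dots+\varepsilon_m)^2x^{2\alpha}+\varepsilon_1^2(1-x)^{2\alpha}+2\varepsilon_1(\varepsilon_2+\dots+\varepsilon_m)\cos(\alpha\pi)\,x^{\alpha}(1-x)^{\alpha}}.$$ When $\alpha=\tfrac12$ and $\varepsilon_1=\varepsilon_2+\dots+\varepsilon_m$, this law is the classical arcsine law, with density $\frac{1}{\pi\sqrt{x(1-x)}}$ on $(0,1)$. -/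

import Mathlib

open MeasureTheory ProbabilityTheory Filter Set
open scoped Topology

noncomputable section

namespace MultiState

/-- A waiting-time law `φ` on the positive half-line of asymptotic power-law type with exponent `α`
and scale `B`: its Laplace transform is `1 - B * s ^ α + o(s ^ α)` as `s` decreases to `0`. -/
structure IsPowerLawWaitingTime (φ : Measure ℝ) (α B : ℝ) : Prop where
  isProbabilityMeasure : IsProbabilityMeasure φ
  positive : φ (Iic 0) = 0
  laplace : Tendsto (fun s : ℝ => (1 - ∫ τ, Real.exp (-(s * τ)) ∂φ) / s ^ α) (𝓝[>] 0) (𝓝 B)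

/-- `J n` is the `n`-th internal state and `T n` the waiting time spent in it. The states form a
Markov chain with initial distribution `p` and transition matrix `M` (`M i j` is the probability
of a transition from `i` to `j`); given the states, the waiting times are independent, and a waiting
time in the state `i` has law `φ i`. The joint law is given by its finite-dimensional
distributions. -/
structure IsMultiStateRenewal {N : ℕ} {Ω : Type*} [MeasurableSpace Ω] (P : Measure Ω)
    (p : Fin N → ℝ) (M : Matrix (Fin N) (Fin N) ℝ) (φ : Fin N → Measure ℝ)
    (J : ℕ → Ω → Fin N) (T : ℕ → Ω → ℝ) : Prop where
  measurable_state : ∀ n, Measurable (J n)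
  measurable_wait : ∀ n, Measurable (T n)
  joint_law : ∀ (n : ℕ) (j : ℕ → Fin N) (A : ℕ → Set ℝ), (∀ k, MeasurableSet (A k)) →
    P {ω | ∀ k ≤ n, J k ω = j k ∧ T k ω ∈ A k} =
      ENNReal.ofReal (p (j 0) * ∏ k ∈ Finset.range n, M (j k) (j (k + 1))) *
        ∏ k ∈ Finset.range (n + 1), φ (j k) (A k)

/-- The time of the `n`-th renewal, `T 0 + ⋯ + T (n - 1)`. -/
def renewalTime {Ω : Type*} (T : ℕ → Ω → ℝ) (n : ℕ) (ω : Ω) : ℝ :=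
  ∑ k ∈ Finset.range n, T k ω

/-- The number of renewals up to time `t`. -/
def renewalCount {Ω : Type*} (T : ℕ → Ω → ℝ) (t : ℝ) (ω : Ω) : ℕ :=
  sSup {n : ℕ | renewalTime T n ω ≤ t}

/-- The internal state `i(t)` at time `t`. -/
def stateAt {N : ℕ} {Ω : Type*} (J : ℕ → Ω → Fin N) (T : ℕ → Ω → ℝ) (t : ℝ) (ω : Ω) : Fin N :=
  J (renewalCount T t ω) ω

/-- The functional `∫₀ᵗ U(i(τ)) dτ` of the path of internal states. -/
def stateFunctional {N : ℕ} {Ω : Type*} (J : ℕ → Ω → Fin N) (T : ℕ → Ω → ℝ)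
    (U : Fin N → ℝ) (t : ℝ) (ω : Ω) : ℝ :=
  ∫ τ in (0 : ℝ)..t, U (stateAt J T τ ω)

/-- The time spent in the state `i` up to time `t`. -/
def occupationTime {N : ℕ} {Ω : Type*} (J : ℕ → Ω → Fin N) (T : ℕ → Ω → ℝ)
    (i : Fin N) (t : ℝ) (ω : Ω) : ℝ :=
  stateFunctional J T (fun j => if j = i then 1 else 0) t ω

/-- As `t → ∞`, the distribution of `X t` under `P` converges weakly to the probability
measure `ν`. -/
def ConvergesInLaw {Ω : Type*} [MeasurableSpace Ω] (X : ℝ → Ω → ℝ) (P : Measure Ω)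
    [IsProbabilityMeasure P] (ν : Measure ℝ) : Prop :=
  ∃ _ : IsProbabilityMeasure ν, TendstoInDistribution X atTop id (fun _ => P) ν

/-- The density, at `x` in `(0, 1)`, of the limit law of the occupation-time fraction; `a` is the
exponent, `u` the weight of the observed state and `v` that of its competitors. -/
def occupationDensity (a u v x : ℝ) : ℝ :=
  Real.sin (Real.pi * a) / Real.pi *
    (u * v * (1 - x) ^ (a - 1) * x ^ (a - 1) /
      (v ^ 2 * x ^ (2 * a) + u ^ 2 * (1 - x) ^ (2 * a) +
        2 * u * v * Real.cos (a * Real.pi) * x ^ a * (1 - x) ^ a))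

/-- The measure on `(0, 1)` with density `occupationDensity a u v`. -/
def occupationLaw (a u v : ℝ) : Measure ℝ :=
  (volume.restrict (Ioo 0 1)).withDensity fun x => ENNReal.ofReal (occupationDensity a u v x)

/-- The classical arcsine law on `(0, 1)`, with density `1 / (π √(x (1 - x)))`. -/
def arcsineLaw : Measure ℝ :=
  (volume.restrict (Ioo 0 1)).withDensity fun x =>
    ENNReal.ofReal (1 / (Real.pi * Real.sqrt (x * (1 - x))))

end MultiState

end

/-! The occupation time `A` of one state is studied through the double Laplace transform `E ∫
exp(-(s t + u A t)) dt`. With `κ i = s + u 1_{i = i₀}` and `ψ i` the Laplace transform of `φ i` at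
`κ i`, decomposing at the first renewal gives the finite system `y i = (1 - ψ i) / κ i + ψ i (M y)
i`, and the double transform is `∑ p i y i` (`IsMultiStateRenewal.exists_laplace`).

Rescaling time by `r` replaces `κ` by `κ / r`, so that `δ i = 1 - ψ i` tends to `0`. In the limit `M
y = y`, and irreducibility makes `y` constant, which removes the initial law. Pairing the system
with `ε` cancels the terms of order one, and the next order determines the constant: `r ^ a δ i`
tends to `B i κ i ^ a` when `α i` equals the minimal exponent `a` and to `0` otherwise, so the limit
is the average of `1 / κ i` with weights `ε i B i κ i ^ a` over the states of minimal exponent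
(`tendsto_of_perturbed_harmonic`, `tendsto_laplace_occupationTime`).

If `A t / t` has limit law `ν`, this number must be `∫ 1 / (c + l x) dν`. For the converse,
`convergesInLaw_of_laplace` reads the transforms with integer parameters as mixed moments at an
independent exponential time, obtains weak convergence on a compact square, and uses that `A` is
Lipschitz to replace the random time by a deterministic one.

It remains to recognise the Stieltjes transform. For the two unit masses this is immediate. For the
density, the substitution `x = sigmoid y` turns it into the jump of `u / (u + v exp(a z))` between
the two edges of the strip `|Im z| ≤ π`, and Cauchy's theorem evaluates the integrals
(`integral_logDensity_mul`, `integral_inv_occupationLaw`). -/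

namespace MultiState

/-! ### Irreducible stochastic matrices and their perturbed harmonic vectors. -/

section Matrix

variable {ι : Type*} [Fintype ι] [DecidableEq ι] {M : Matrix ι ι ℝ}

/-- A fixed vector of an irreducible stochastic matrix is constant. -/
lemma eq_of_mulVec_eq_self (hM : M ∈ Matrix.rowStochastic ℝ ι) (hirr : M.IsIrreducible)
    {y : ι → ℝ} (hy : M.mulVec y = y) (i j : ι) : y i = y j := by
  have : Nonempty ι := ⟨i⟩
  obtain ⟨m, hm⟩ := Finite.exists_max y
  suffices h : ∀ j, y j = y m by rw [h i, h j]
  intro j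
  -- Maximum principle: `y m` is an average of `y` under row `m` of `M ^ k`, which charges `j`. The
  -- power depends on `j`, so periodic chains are allowed.
  obtain ⟨k, -, hk⟩ := (Matrix.isIrreducible_iff_exists_pow_pos hirr.nonneg).1 hirr m j
  have hMk : M ^ k ∈ Matrix.rowStochastic ℝ ι := pow_mem hM k
  have hyk : (M ^ k).mulVec y = y := by
    clear hk hMk
    induction k with
    | zero => simp
    | succ k ih => rw [pow_succ, ← Matrix.mulVec_mulVec, hy, ih]
  have h0 : ∑ l, (M ^ k) m l * (y m - y l) = 0 := by
    have h1 : ∑ l, (M ^ k) m l * y l = y m := by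
      simpa [Matrix.mulVec, dotProduct] using congrFun hyk m
    simp_rw [mul_sub, Finset.sum_sub_distrib, h1, ← Finset.sum_mul,
      Matrix.sum_row_of_mem_rowStochastic hMk]
    ring
  have h2 := (Finset.sum_eq_zero_iff_of_nonneg fun l _ =>
    mul_nonneg (Matrix.nonneg_of_mem_rowStochastic hMk) (sub_nonneg.2 (hm l))).1 h0 j
    (Finset.mem_univ j)
  rcases mul_eq_zero.1 h2 with h | h <;> linarith

/-- The equilibrium distribution of an irreducible stochastic matrix charges every state. -/
lemma equilibrium_pos (hirr : M.IsIrreducible) {ε : ι → ℝ} (hε : ε ∈ stdSimplex ℝ ι)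
    (heq : Matrix.vecMul ε M = ε) (j : ι) : 0 < ε j := by
  obtain ⟨i, hi⟩ : ∃ i, 0 < ε i := by
    by_contra! h
    have := Finset.sum_nonpos fun i (_ : i ∈ Finset.univ) => h i
    rw [hε.2] at this
    linarith
  obtain ⟨k, -, hk⟩ := (Matrix.isIrreducible_iff_exists_pow_pos hirr.nonneg).1 hirr i j
  have hnn : ∀ k i j, 0 ≤ (M ^ k) i j := by
    intro k
    induction k with
    | zero => intro i j; by_cases h : i = j <;> simp [h]
    | succ k ih =>
      intro i j
      rw [pow_succ, Matrix.mul_apply]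
      exact Finset.sum_nonneg fun l _ => mul_nonneg (ih i l) (hirr.nonneg l j)
  have hek : Matrix.vecMul ε (M ^ k) = ε := by
    clear hk
    induction k with
    | zero => simp
    | succ k ih => rw [pow_succ, ← Matrix.vecMul_vecMul, ih, heq]
  calc 0 < ε i * (M ^ k) i j := mul_pos hi hk
    _ ≤ ∑ l, ε l * (M ^ k) l j :=
      Finset.single_le_sum (f := fun l => ε l * (M ^ k) l j)
        (fun l _ => mul_nonneg (hε.1 l) (hnn k l j)) (Finset.mem_univ i)
    _ = ε j := by simpa [Matrix.vecMul, dotProduct] using congrFun hek j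

/-- Bounded solutions `y` of `y = δ / κ + (1 - δ) M y` become constant when `δ → 0`, the
constant being an average of `1 / κ` with weights the equilibrium distribution times the rates
at which `δ` vanishes. -/
lemma tendsto_of_perturbed_harmonic (hM : M ∈ Matrix.rowStochastic ℝ ι)
    (hirr : M.IsIrreducible) {ε : ι → ℝ} (heq : Matrix.vecMul ε M = ε)
    {β : Type*} {l : Filter β} {δ : β → ι → ℝ} {w : β → ℝ} {y : β → ι → ℝ} {b κ : ι → ℝ} {C : ℝ}
    (hδ : ∀ i, Tendsto (fun r => δ r i) l (𝓝 0))
    (hb : ∀ i, Tendsto (fun r => w r * δ r i) l (𝓝 (b i)))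
    (hb0 : ∑ i, ε i * b i ≠ 0)
    (hy0 : ∀ᶠ r in l, ∀ i, 0 ≤ y r i ∧ y r i ≤ C)
    (hy : ∀ᶠ r in l, ∀ i, y r i = δ r i / κ i + (1 - δ r i) * M.mulVec (y r) i) :
    Tendsto y l (𝓝 fun _ => (∑ i, ε i * b i / κ i) / ∑ i, ε i * b i) := by
  have hKc : IsCompact (Set.univ.pi fun _ : ι => Set.Icc (0 : ℝ) C) :=
    isCompact_univ_pi fun _ => isCompact_Icc
  -- By compactness it is enough to identify the cluster points; each is a limit along an
  -- ultrafilter.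
  refine hKc.tendsto_nhds_of_unique_mapClusterPt
    (hy0.mono fun r hr i _ => ⟨(hr i).1, (hr i).2⟩) fun x _ hx => ?_
  obtain ⟨U, hUl, hU⟩ := mapClusterPt_iff_ultrafilter.1 hx
  have hUi : ∀ i, Tendsto (fun r => y r i) U (𝓝 (x i)) := tendsto_pi_nhds.1 hU
  have hMU : ∀ i, Tendsto (fun r => M.mulVec (y r) i) U (𝓝 (M.mulVec x i)) := fun i =>
    ((continuous_apply i).comp
      (Continuous.matrix_mulVec continuous_const continuous_id)).continuousAt.tendsto.comp hU
  have hyU := hy.filter_mono hUl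
  have hfix : M.mulVec x = x := by
    funext i
    have h1 : Tendsto (fun r => δ r i / κ i + (1 - δ r i) * M.mulVec (y r) i) U
        (𝓝 (0 / κ i + (1 - 0) * M.mulVec x i)) :=
      (((hδ i).mono_left hUl).div_const _).add
        ((((hδ i).mono_left hUl).const_sub 1).mul (hMU i))
    have h2 := tendsto_nhds_unique (h1.congr' (hyU.mono fun r hr => (hr i).symm)) (hUi i)
    simpa using h2
  -- Since `ε M = ε`, pairing the equation with `ε` cancels the terms of order one; multiplying by
  -- `w` gives what remains a nontrivial limit.
  have hbal : ∀ᶠ r in (U : Filter β),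
      ∑ i, ε i * (w r * δ r i) * M.mulVec (y r) i = ∑ i, ε i * (w r * δ r i) / κ i := by
    filter_upwards [hyU] with r hr
    have h1 : ∑ i, ε i * M.mulVec (y r) i = ∑ i, ε i * y r i := by
      have := Matrix.dotProduct_mulVec ε M (y r)
      rw [heq] at this
      simpa [dotProduct] using this
    have h2 : ∑ i, ε i * y r i = ∑ i, (ε i * δ r i / κ i + ε i * M.mulVec (y r) i -
        ε i * δ r i * M.mulVec (y r) i) := by
      refine Finset.sum_congr rfl fun i _ => ?_
      rw [hr i]; ring
    rw [Finset.sum_sub_distrib, Finset.sum_add_distrib, h1] at h2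
    have h3 : ∑ i, ε i * δ r i * M.mulVec (y r) i = ∑ i, ε i * δ r i / κ i := by linarith
    calc _ = w r * ∑ i, ε i * δ r i * M.mulVec (y r) i := by
          rw [Finset.mul_sum]; exact Finset.sum_congr rfl fun i _ => by ring
      _ = _ := by
          rw [h3, Finset.mul_sum]; exact Finset.sum_congr rfl fun i _ => by ring
  have hlim : ∑ i, ε i * b i * M.mulVec x i = ∑ i, ε i * b i / κ i := by
    refine tendsto_nhds_unique ((tendsto_finsetSum _ fun i _ =>
      ((((hb i).mono_left hUl).const_mul (ε i)).mul (hMU i))).congr' hbal)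
      (tendsto_finsetSum _ fun i _ =>
        ((((hb i).mono_left hUl).const_mul (ε i)).div_const _))
  funext i
  rw [eq_div_iff hb0, ← hlim, hfix, Finset.mul_sum]
  refine Finset.sum_congr rfl fun j _ => ?_
  rw [eq_of_mulVec_eq_self hM hirr hfix i j]; ring

end Matrix

/-! ### Expectations of products along the path of the chain. -/

section PathLaw

variable {N : ℕ} {Ω : Type*} [MeasurableSpace Ω] {P : Measure Ω}
  {p : Fin N → ℝ} {M : Matrix (Fin N) (Fin N) ℝ} {φ : Fin N → Measure ℝ}
  {J : ℕ → Ω → Fin N} {T : ℕ → Ω → ℝ}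

/-- The joint law of the first waiting times on the event that the chain follows a given path. -/
lemma IsMultiStateRenewal.map_restrict_path [∀ i, IsFiniteMeasure (φ i)]
    (h : IsMultiStateRenewal P p M φ J T) {n : ℕ} (w : Fin (n + 1) → Fin N) :
    (P.restrict {ω | ∀ k : Fin (n + 1), J k ω = w k}).map (fun ω (k : Fin (n + 1)) => T k ω) =
      Measure.pi fun k => (if k = 0 then
        (p (w 0) * ∏ k : Fin n, M (w k.castSucc) (w k.succ)).toNNReal else 1) • φ (w k) := by
  symm
  -- Boxes determine a product measure. The scalar weight of the path is carried by coordinate `0`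
  -- alone, which keeps the restricted law a product.
  refine Measure.pi_eq fun s hs => ?_
  have hmeas : Measurable fun ω (k : Fin (n + 1)) => T k ω :=
    measurable_pi_iff.2 fun k => h.measurable_wait k
  rw [Measure.map_apply hmeas (MeasurableSet.univ_pi hs),
    Measure.restrict_apply (hmeas (MeasurableSet.univ_pi hs))]
  -- `joint_law` asks for infinite sequences; the padding beyond index `n` is never read.
  have hj := h.joint_law n (fun k => if hk : k < n + 1 then w ⟨k, hk⟩ else w 0)
    (fun k => if hk : k < n + 1 then s ⟨k, hk⟩ else ∅) (fun k => by
      split_ifs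
      · exact hs _
      · exact MeasurableSet.empty)
  have hset : (fun ω (k : Fin (n + 1)) => T k ω) ⁻¹' univ.pi s ∩
      {ω | ∀ k : Fin (n + 1), J k ω = w k} =
      {ω | ∀ k ≤ n, J k ω = (if hk : k < n + 1 then w ⟨k, hk⟩ else w 0) ∧
        T k ω ∈ (if hk : k < n + 1 then s ⟨k, hk⟩ else ∅)} := by
    ext ω
    simp only [mem_inter_iff, mem_preimage, mem_univ_pi, mem_ofPred_eq]
    constructor
    · rintro ⟨h1, h2⟩ k hk
      have hk' : k < n + 1 := by omega
      simp only [hk', dif_pos]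
      exact ⟨h2 ⟨k, hk'⟩, h1 ⟨k, hk'⟩⟩
    · intro h1
      constructor
      · intro k
        simpa only [k.is_lt, dif_pos] using (h1 k (by omega)).2
      · intro k
        simpa only [k.is_lt, dif_pos] using (h1 k (by omega)).1
  rw [hset, hj, Finset.prod_range (n := n), Finset.prod_range (n := n + 1)]
  have h1 : ∀ k : Fin n, (k : ℕ) < n + 1 := fun k => by omega
  have h2 : ∀ k : Fin n, (k : ℕ) + 1 < n + 1 := fun k => by omega
  simp only [h1, h2, dif_pos, Nat.zero_lt_succ, Fin.is_lt, Measure.smul_apply]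
  rw [Fin.prod_univ_succ, Fin.prod_univ_succ]
  simp [ENNReal.smul_def, ENNReal.ofReal, mul_assoc, Fin.castSucc,
    Fin.succ]
  rfl

/-- The expectation of a product along the path, on the event that the chain follows a given
path. -/
lemma IsMultiStateRenewal.setIntegral_path [∀ i, IsFiniteMeasure (φ i)]
    (h : IsMultiStateRenewal P p M φ J T) {n : ℕ} (w : Fin (n + 1) → Fin N)
    (hc : 0 ≤ p (w 0) * ∏ k : Fin n, M (w k.castSucc) (w k.succ))
    {f : Fin (n + 1) → Fin N → ℝ → ℝ} (hf : ∀ k i, Integrable (f k i) (φ i))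
    (hfm : ∀ k i, Measurable (f k i)) :
    IntegrableOn (fun ω => ∏ k, f k (J k ω) (T k ω)) {ω | ∀ k : Fin (n + 1), J k ω = w k} P ∧
    ∫ ω in {ω | ∀ k : Fin (n + 1), J k ω = w k}, ∏ k, f k (J k ω) (T k ω) ∂P =
      (p (w 0) * ∏ k : Fin n, M (w k.castSucc) (w k.succ)) *
        ∏ k, ∫ τ, f k (w k) τ ∂(φ (w k)) := by
  have hmeas : Measurable fun ω (k : Fin (n + 1)) => T k ω :=
    measurable_pi_iff.2 fun k => h.measurable_wait k
  have hE : MeasurableSet {ω | ∀ k : Fin (n + 1), J k ω = w k} := by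
    rw [ofPred_forall]
    exact MeasurableSet.iInter fun k => h.measurable_state k (measurableSet_singleton _)
  have hF : Measurable fun x : Fin (n + 1) → ℝ => ∏ k, f k (w k) (x k) :=
    Finset.measurable_prod _ fun k _ => (hfm k _).comp (measurable_pi_apply k)
  have hcongr : EqOn (fun ω => ∏ k, f k (J k ω) (T k ω))
      (fun ω => ∏ k : Fin (n + 1), f k (w k) (T k ω)) {ω | ∀ k : Fin (n + 1), J k ω = w k} := by
    intro ω hω
    exact Finset.prod_congr rfl fun k _ => by rw [hω k]
  have hlaw := h.map_restrict_path w
  constructor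
  · rw [integrableOn_congr_fun hcongr hE]
    have h1 : Integrable (fun x : Fin (n + 1) → ℝ => ∏ k, f k (w k) (x k))
        ((P.restrict {ω | ∀ k : Fin (n + 1), J k ω = w k}).map
          (fun ω (k : Fin (n + 1)) => T k ω)) := by
      rw [hlaw]
      exact Integrable.fintype_prod fun k => (hf k _).smul_measure_nnreal
    exact h1.comp_measurable hmeas
  · rw [setIntegral_congr_fun hE hcongr,
      ← integral_map (μ := P.restrict {ω | ∀ k : Fin (n + 1), J k ω = w k}) hmeas.aemeasurable
        (f := fun x => ∏ k, f k (w k) (x k)) hF.aestronglyMeasurable, hlaw,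
      integral_fintype_prod_eq_prod (fun k => f k (w k))]
    simp_rw [integral_smul_nnreal_measure]
    rw [Fin.prod_univ_succ, Fin.prod_univ_succ (f := fun k => ∫ τ, f k (w k) τ ∂(φ (w k)))]
    simp [Fin.succ_ne_zero, NNReal.smul_def, Real.coe_toNNReal _ hc, mul_assoc]

/-- Sums over paths of products of transition weights are entries of matrix powers. -/
lemma sum_path_prod {ι : Type*} [Fintype ι] [DecidableEq ι] (K : Matrix ι ι ℝ) (d : ι → ℝ) (n : ℕ)
    (q : ι → ℝ) :
    ∑ w : Fin (n + 1) → ι, q (w 0) * (∏ k : Fin n, K (w k.castSucc) (w k.succ)) *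
      d (w (Fin.last n)) = dotProduct q ((K ^ n).mulVec d) := by
  induction n generalizing q with
  | zero =>
    rw [← (Equiv.funUnique (Fin 1) ι).symm.sum_comp]
    simp [dotProduct]
  | succ n ih =>
    -- The first state is summed out into the row vector, `q` becoming `q K`; hence an induction
    -- over all `q`.
    rw [← (Fin.consEquiv fun _ => ι).sum_comp, Fintype.sum_prod_type_right, pow_succ',
      ← Matrix.mulVec_mulVec, Matrix.dotProduct_mulVec, ← ih]
    refine Finset.sum_congr rfl fun w _ => ?_
    rw [Matrix.vecMul, dotProduct, Finset.sum_mul, Finset.sum_mul]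
    refine Finset.sum_congr rfl fun i _ => ?_
    rw [Fin.prod_univ_succ]
    have : Fin.last (n + 1) = (Fin.last n).succ := rfl
    simp [Fin.consEquiv, this, -Fin.succ_last, mul_assoc]

/-- The expectation of a product along the path, with a possibly different last factor. -/
lemma IsMultiStateRenewal.integral_prod [∀ i, IsProbabilityMeasure (φ i)]
    (h : IsMultiStateRenewal P p M φ J T) (hp : ∀ i, 0 ≤ p i) (hM : ∀ i j, 0 ≤ M i j)
    {f g : Fin N → ℝ → ℝ} (hf : ∀ i, Integrable (f i) (φ i)) (hfm : ∀ i, Measurable (f i))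
    (hg : ∀ i, Integrable (g i) (φ i)) (hgm : ∀ i, Measurable (g i)) (n : ℕ) :
    Integrable (fun ω => (∏ k ∈ Finset.range n, f (J k ω) (T k ω)) * g (J n ω) (T n ω)) P ∧
    ∫ ω, (∏ k ∈ Finset.range n, f (J k ω) (T k ω)) * g (J n ω) (T n ω) ∂P =
      dotProduct p ((Matrix.of (fun i j => (∫ τ, f i τ ∂(φ i)) * M i j) ^ n).mulVec
        fun i => ∫ τ, g i τ ∂(φ i)) := by
  set F : Fin (n + 1) → Fin N → ℝ → ℝ := fun k => if k = Fin.last n then g else f with hF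
  have hFi : ∀ k i, Integrable (F k i) (φ i) := fun k i => by
    simp only [hF]; split_ifs
    exacts [hg i, hf i]
  have hFm : ∀ k i, Measurable (F k i) := fun k i => by
    simp only [hF]; split_ifs
    exacts [hgm i, hfm i]
  have hprod : (fun ω => (∏ k ∈ Finset.range n, f (J k ω) (T k ω)) * g (J n ω) (T n ω)) =
      fun ω => ∏ k, F k (J k ω) (T k ω) := by
    funext ω
    rw [Finset.prod_range, Fin.prod_univ_castSucc]
    simp [hF, Fin.castSucc_ne_last]
  have hE : ∀ w : Fin (n + 1) → Fin N,
      MeasurableSet {ω | ∀ k : Fin (n + 1), J k ω = w k} := fun w => by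
    rw [ofPred_forall]
    exact MeasurableSet.iInter fun k => h.measurable_state k (measurableSet_singleton _)
  have hdisj : Pairwise (Function.onFun Disjoint
      fun w : Fin (n + 1) → Fin N => {ω | ∀ k : Fin (n + 1), J k ω = w k}) := by
    intro w w' hw
    refine Set.disjoint_left.2 fun ω h1 h2 => hw ?_
    funext k
    rw [← h1 k, ← h2 k]
  have hU : (⋃ w : Fin (n + 1) → Fin N, {ω | ∀ k : Fin (n + 1), J k ω = w k}) = univ :=
    eq_univ_of_forall fun ω => mem_iUnion.2 ⟨fun k => J k ω, fun _ => rfl⟩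
  have hc : ∀ w : Fin (n + 1) → Fin N,
      0 ≤ p (w 0) * ∏ k : Fin n, M (w k.castSucc) (w k.succ) := fun w =>
    mul_nonneg (hp _) (Finset.prod_nonneg fun _ _ => hM _ _)
  have hw := fun w => h.setIntegral_path w (hc w) hFi hFm
  rw [hprod]
  constructor
  · rw [← integrableOn_univ, ← hU, integrableOn_finite_iUnion]
    exact fun w => (hw w).1
  · rw [← setIntegral_univ, ← hU, integral_iUnion_fintype hE hdisj fun w => (hw w).1,
      ← sum_path_prod]
    refine Finset.sum_congr rfl fun w _ => ?_
    rw [(hw w).2, Fin.prod_univ_castSucc]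
    simp only [hF, Fin.castSucc_ne_last, if_false, if_true, Matrix.of_apply]
    rw [Finset.prod_mul_distrib]
    ring

end PathLaw

/-! ### Measurability and Lipschitz continuity of the occupation time. -/

section Measurability

variable {N : ℕ} {Ω : Type*} {J : ℕ → Ω → Fin N} {T : ℕ → Ω → ℝ}

/-- A countable supremum of indicators is visibly jointly measurable. The extra zeros do not change
the upper bounds in `ℕ`, and when there are none both sides take the same default value. -/
lemma renewalCount_eq_iSup (t : ℝ) (ω : Ω) :
    renewalCount T t ω = ⨆ n : ℕ, {n | renewalTime T n ω ≤ t}.indicator id n := by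
  set A := {n | renewalTime T n ω ≤ t} with hA
  have hub : upperBounds (range fun n => A.indicator id n) = upperBounds A := by
    ext b
    simp only [mem_upperBounds, forall_mem_range]
    constructor
    · intro h n hn
      simpa [indicator_of_mem hn] using h n
    · intro h n
      by_cases hn : n ∈ A
      · simpa [indicator_of_mem hn] using h n hn
      · simp [indicator_of_notMem hn]
  change sSup A = sSup (range fun n => A.indicator id n)
  by_cases hb : BddAbove A
  · rcases A.eq_empty_or_nonempty with h0 | h0
    · simp [h0]
    · have h1 : IsLUB (range fun n => A.indicator id n) (sSup A) := by
        rw [IsLUB, hub]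
        exact isLUB_csSup h0 hb
      exact (h1.csSup_eq (range_nonempty _)).symm
  · have hb' : ¬ BddAbove (range fun n => A.indicator id n) := by rwa [BddAbove, hub]
    rw [csSup_of_not_bddAbove hb, csSup_of_not_bddAbove hb']

variable [MeasurableSpace Ω]

lemma measurable_renewalTime (hT : ∀ n, Measurable (T n)) (n : ℕ) :
    Measurable (renewalTime T n) :=
  Finset.measurable_sum _ fun k _ => hT k

lemma measurable_renewalCount (hT : ∀ n, Measurable (T n)) :
    Measurable fun x : ℝ × Ω => renewalCount T x.1 x.2 := by
  simp_rw [renewalCount_eq_iSup]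
  refine Measurable.iSup fun n => ?_
  have hs : MeasurableSet {x : ℝ × Ω | renewalTime T n x.2 ≤ x.1} :=
    measurableSet_le ((measurable_renewalTime hT n).comp measurable_snd) measurable_fst
  exact Measurable.indicator (f := fun _ => n) measurable_const hs

lemma measurable_stateAt (hJ : ∀ n, Measurable (J n)) (hT : ∀ n, Measurable (T n)) :
    Measurable fun x : ℝ × Ω => stateAt J T x.1 x.2 :=
  (measurable_from_prod_countable_right (f := fun x : ℕ × Ω => J x.1 x.2) hJ).comp
    ((measurable_renewalCount hT).prodMk measurable_snd)

variable (hJ : ∀ n, Measurable (J n)) (hT : ∀ n, Measurable (T n)) (i : Fin N)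
include hJ hT

lemma measurable_occupation_integrand :
    Measurable fun x : ℝ × Ω => if stateAt J T x.1 x.2 = i then (1 : ℝ) else 0 :=
  Measurable.ite (measurable_stateAt hJ hT (measurableSet_singleton i)) measurable_const
    measurable_const

lemma intervalIntegrable_occupation (ω : Ω) (a b : ℝ) :
    IntervalIntegrable (fun τ => if stateAt J T τ ω = i then (1 : ℝ) else 0) volume a b := by
  refine (intervalIntegrable_const (c := (1 : ℝ))).mono_fun
    ((measurable_occupation_integrand hJ hT i).comp
      (measurable_id.prodMk measurable_const)).aestronglyMeasurable (ae_of_all _ fun τ => ?_)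
  dsimp only
  split_ifs <;> simp

lemma occupationTime_sub (ω : Ω) (a b : ℝ) :
    occupationTime J T i b ω - occupationTime J T i a ω =
      ∫ τ in a..b, if stateAt J T τ ω = i then (1 : ℝ) else 0 := by
  rw [occupationTime, occupationTime, stateFunctional, stateFunctional,
    intervalIntegral.integral_interval_sub_left]
  exacts [intervalIntegrable_occupation hJ hT i ω _ _, intervalIntegrable_occupation hJ hT i ω _ _]

lemma occupationTime_sub_mem (ω : Ω) {a b : ℝ} (hab : a ≤ b) :
    occupationTime J T i b ω - occupationTime J T i a ω ∈ Icc 0 (b - a) := by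
  rw [occupationTime_sub hJ hT]
  constructor
  · refine intervalIntegral.integral_nonneg hab fun τ _ => ?_
    split_ifs <;> simp
  · have := intervalIntegral.integral_mono_on hab
      (intervalIntegrable_occupation hJ hT i ω a b) (intervalIntegrable_const (c := (1 : ℝ)))
      fun τ _ => by split_ifs <;> simp
    simpa using this

lemma occupationTime_lipschitz (ω : Ω) (a b : ℝ) :
    |occupationTime J T i b ω - occupationTime J T i a ω| ≤ |b - a| := by
  rcases le_total a b with h | h
  · have := occupationTime_sub_mem hJ hT i ω h
    rw [abs_of_nonneg this.1, abs_of_nonneg (sub_nonneg.2 h)]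
    exact this.2
  · have := occupationTime_sub_mem hJ hT i ω h
    rw [abs_sub_comm, abs_sub_comm b, abs_of_nonneg this.1, abs_of_nonneg (sub_nonneg.2 h)]
    exact this.2

lemma continuous_occupationTime (ω : Ω) : Continuous fun t => occupationTime J T i t ω :=
  (LipschitzWith.of_dist_le_mul (K := 1) fun a b => by
    simpa [Real.dist_eq] using occupationTime_lipschitz hJ hT i ω b a).continuous

lemma measurable_occupationTime (t : ℝ) : Measurable (occupationTime J T i t) := by
  have h : Measurable fun x : Ω × ℝ => if stateAt J T x.2 x.1 = i then (1 : ℝ) else 0 :=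
    (measurable_occupation_integrand hJ hT i).comp measurable_swap
  unfold occupationTime stateFunctional
  simp_rw [intervalIntegral.intervalIntegral_eq_integral_uIoc]
  have h2 := (h.stronglyMeasurable.integral_prod_right'
    (ν := volume.restrict (uIoc 0 t))).measurable
  exact h2.const_mul (if 0 ≤ t then (1 : ℝ) else -1)

end Measurability

/-! ### Pathwise decomposition at the renewals. -/

section Path

variable {N : ℕ} {Ω : Type*} {J : ℕ → Ω → Fin N} {T : ℕ → Ω → ℝ} {ω : Ω}

lemma renewalTime_zero : renewalTime T 0 ω = 0 := by simp [renewalTime]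

lemma renewalTime_succ (n : ℕ) : renewalTime T (n + 1) ω = renewalTime T n ω + T n ω := by
  simp [renewalTime, Finset.sum_range_succ]

/-- Positive waiting times make the renewal times strictly increasing, so the supremum defining the
count is attained at `n`. -/
lemma stateAt_eq (hpos : ∀ n, 0 < T n ω) {n : ℕ} {t : ℝ} (h1 : renewalTime T n ω ≤ t)
    (h2 : t < renewalTime T (n + 1) ω) : stateAt J T t ω = J n ω := by
  have hmono : StrictMono fun n => renewalTime T n ω :=
    strictMono_nat_of_lt_succ fun n => by rw [renewalTime_succ]; linarith [hpos n]
  have : {m : ℕ | renewalTime T m ω ≤ t} = Iic n := by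
    ext m
    simp only [mem_ofPred_eq, mem_Iic]
    constructor
    · intro hm
      exact Nat.lt_succ_iff.1 (hmono.lt_iff_lt.1 (hm.trans_lt h2))
    · intro hm
      exact (hmono.monotone hm).trans h1
  rw [stateAt, renewalCount, this, csSup_Iic]

variable [MeasurableSpace Ω]

lemma occupationTime_renewalTime_add (hJ : ∀ n, Measurable (J n)) (hT : ∀ n, Measurable (T n))
    (i : Fin N) (hpos : ∀ n, 0 < T n ω) (n : ℕ) {r : ℝ}
    (hr0 : 0 ≤ r) (hr : r ≤ T n ω) :
    occupationTime J T i (renewalTime T n ω + r) ω =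
      occupationTime J T i (renewalTime T n ω) ω + (if J n ω = i then 1 else 0) * r := by
  have h : renewalTime T n ω ≤ renewalTime T n ω + r := by linarith
  -- The right endpoint is dropped: for `r = T n ω` the process has already jumped there.
  rw [← sub_eq_iff_eq_add', occupationTime_sub hJ hT, intervalIntegral.integral_of_le h,
    integral_Ioc_eq_integral_Ioo, setIntegral_congr_fun (g := fun _ => if J n ω = i then 1 else 0)
      measurableSet_Ioo]
  · simp [hr0]
  · intro τ hτ
    dsimp only
    rw [stateAt_eq hpos hτ.1.le]
    rw [renewalTime_succ]
    linarith [hτ.2]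

/-- Along a path, the integral of the discounted exponential functional up to a renewal. -/
lemma integral_exp_renewalTime (hJ : ∀ n, Measurable (J n)) (hT : ∀ n, Measurable (T n))
    (i : Fin N) (hpos : ∀ n, 0 < T n ω) {s u : ℝ} (hs : 0 < s) (hu : 0 ≤ u) (n : ℕ) :
    s * renewalTime T n ω + u * occupationTime J T i (renewalTime T n ω) ω =
        ∑ k ∈ Finset.range n, (s + u * (if J k ω = i then 1 else 0)) * T k ω ∧
    ∫ t in 0..renewalTime T n ω, Real.exp (-(s * t + u * occupationTime J T i t ω)) =
      ∑ k ∈ Finset.range n,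
        (∏ l ∈ Finset.range k, Real.exp (-((s + u * (if J l ω = i then 1 else 0)) * T l ω))) *
        ((1 - Real.exp (-((s + u * (if J k ω = i then 1 else 0)) * T k ω))) /
          (s + u * (if J k ω = i then 1 else 0))) := by
  have hcont : Continuous fun t => Real.exp (-(s * t + u * occupationTime J T i t ω)) :=
    Real.continuous_exp.comp (((continuous_const.mul continuous_id).add
      (continuous_const.mul (continuous_occupationTime hJ hT i ω))).neg)
  induction n with
  | zero => simp [renewalTime_zero, occupationTime, stateFunctional]
  | succ n ih =>
    set κ := s + u * (if J n ω = i then 1 else 0) with hκ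
    have hκ0 : 0 < κ := by
      rw [hκ]
      split_ifs <;> simp <;> linarith
    constructor
    · rw [Finset.sum_range_succ, ← ih.1, renewalTime_succ,
        occupationTime_renewalTime_add hJ hT i hpos n (hpos n).le le_rfl]
      ring
    · rw [Finset.sum_range_succ, ← ih.2, ← intervalIntegral.integral_add_adjacent_intervals
        (hcont.intervalIntegrable _ _) (hcont.intervalIntegrable (renewalTime T n ω) _)]
      congr 1
      rw [← Real.exp_sum, Finset.sum_neg_distrib, ← ih.1, renewalTime_succ]
      have h1 := intervalIntegral.integral_comp_add_left (a := 0) (b := T n ω)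
        (fun t => Real.exp (-(s * t + u * occupationTime J T i t ω))) (renewalTime T n ω)
      rw [add_zero] at h1
      rw [← h1]
      -- During the `n`-th sojourn the exponent is affine with slope `κ`, so the past factors out.
      have h2 : ∀ r ∈ uIcc 0 (T n ω),
          Real.exp (-(s * (renewalTime T n ω + r) +
            u * occupationTime J T i (renewalTime T n ω + r) ω)) =
          Real.exp (-(s * renewalTime T n ω + u * occupationTime J T i (renewalTime T n ω) ω)) *
            Real.exp (-κ * r) := by
        intro r hr
        rw [uIcc_of_le (hpos n).le] at hr
        rw [occupationTime_renewalTime_add hJ hT i hpos n hr.1 hr.2, ← Real.exp_add]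
        congr 1
        ring
      rw [intervalIntegral.integral_congr h2, intervalIntegral.integral_const_mul]
      congr 1
      rw [intervalIntegral.integral_comp_mul_left (fun x => Real.exp x) (neg_ne_zero.2 hκ0.ne'),
        integral_exp]
      rw [mul_zero, Real.exp_zero, smul_eq_mul, ← hκ, neg_mul]
      field_simp
      ring

end Path

/-! ### Laplace transforms of laws on the positive half-line. -/

section Laplace

variable {φ : Measure ℝ} {s : ℝ}

lemma ae_pos_of_Iic (h0 : φ (Iic 0) = 0) : ∀ᵐ τ ∂φ, 0 < τ := by
  rw [ae_iff]
  refine measure_mono_null (fun τ hτ => ?_) h0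
  simpa using hτ

lemma measurable_exp_neg_mul (s : ℝ) : Measurable fun τ : ℝ => Real.exp (-(s * τ)) := by
  fun_prop

variable [IsProbabilityMeasure φ] (h0 : φ (Iic 0) = 0)
include h0

lemma integrable_exp_neg_mul (hs : 0 ≤ s) : Integrable (fun τ => Real.exp (-(s * τ))) φ := by
  refine (integrable_const (1 : ℝ)).mono' (measurable_exp_neg_mul s).aestronglyMeasurable ?_
  filter_upwards [ae_pos_of_Iic h0] with τ hτ
  rw [Real.norm_eq_abs, abs_of_pos (Real.exp_pos _), Real.exp_le_one_iff]
  nlinarith [mul_nonneg hs hτ.le]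

lemma integral_exp_neg_mul_lt_one (hs : 0 < s) : ∫ τ, Real.exp (-(s * τ)) ∂φ < 1 := by
  have hi := integrable_exp_neg_mul h0 hs.le
  have h1 : 0 < ∫ τ, (1 - Real.exp (-(s * τ))) ∂φ := by
    rw [integral_pos_iff_support_of_nonneg_ae]
    · have : φ (Function.support fun τ => 1 - Real.exp (-(s * τ))) = 1 := by
        rw [← measure_univ (μ := φ)]
        refine measure_congr ?_
        filter_upwards [ae_pos_of_Iic h0] with τ hτ
        refine propext ⟨fun _ => trivial, fun _ => ?_⟩
        refine Function.mem_support.2 (ne_of_gt ?_)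
        have : Real.exp (-(s * τ)) < 1 := by
          rw [Real.exp_lt_one_iff]
          nlinarith [mul_pos hs hτ]
        linarith
      rw [this]; exact one_pos
    · filter_upwards [ae_pos_of_Iic h0] with τ hτ
      have : Real.exp (-(s * τ)) ≤ 1 := by
        rw [Real.exp_le_one_iff]
        nlinarith [mul_pos hs hτ]
      simpa using this
    · exact (integrable_const _).sub hi
  rw [integral_sub (integrable_const _) hi] at h1
  simpa using h1

end Laplace

/-! ### The renewal equation for the double Laplace transform. -/

section Expectation

variable {N : ℕ} {Ω : Type*} [MeasurableSpace Ω] {P : Measure Ω}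
  {p : Fin N → ℝ} {M : Matrix (Fin N) (Fin N) ℝ} {φ : Fin N → Measure ℝ}
  {J : ℕ → Ω → Fin N} {T : ℕ → Ω → ℝ}

variable [∀ i, IsProbabilityMeasure (φ i)]
  (h : IsMultiStateRenewal P p M φ J T) (hp : p ∈ stdSimplex ℝ (Fin N))
  (hM : M ∈ Matrix.rowStochastic ℝ (Fin N)) (h0 : ∀ i, φ i (Iic 0) = 0)

include h hp hM h0

/-- With the indicator of `Iic 0` as last factor, the expectation along the path vanishes. -/
lemma IsMultiStateRenewal.ae_wait_pos : ∀ᵐ ω ∂P, ∀ n, 0 < T n ω := by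
  refine ae_all_iff.2 fun n => ?_
  have h1 := h.integral_prod hp.1 (fun i j => Matrix.nonneg_of_mem_rowStochastic hM)
    (f := fun _ _ => 1) (g := fun _ => (Iic 0).indicator fun _ => 1)
    (fun _ => integrable_const _) (fun _ => measurable_const)
    (fun _ => (integrable_const _).indicator measurableSet_Iic)
    (fun _ => measurable_const.indicator measurableSet_Iic) n
  have h2 : (fun i => ∫ τ, (Iic 0).indicator (fun _ => (1 : ℝ)) τ ∂(φ i)) = 0 := by
    funext i
    rw [integral_indicator_const _ measurableSet_Iic]
    simp [measureReal_def, h0]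
  rw [h2, Matrix.mulVec_zero, dotProduct_zero] at h1
  have h3 := (integral_eq_zero_iff_of_nonneg (fun ω => ?_) h1.1).1 h1.2
  · filter_upwards [h3] with ω hω
    by_contra hneg
    simp [indicator_of_mem (show T n ω ∈ Iic 0 from not_lt.1 hneg)] at hω
  · simp only [Finset.prod_const_one, one_mul]
    exact indicator_nonneg (fun _ _ => zero_le_one) _

/-- The expectation of `exp (-renewalTime T n ω)` is at most `ψ m ^ n`, where `ψ m < 1` is the
largest of the finitely many Laplace transforms at `1`. The sum over `n` is therefore almost surely
finite and its terms tend to `0`. -/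
lemma IsMultiStateRenewal.ae_renewalTime_tendsto :
    ∀ᵐ ω ∂P, Tendsto (fun n => renewalTime T n ω) atTop atTop := by
  rcases isEmpty_or_nonempty (Fin N) with hN | hN
  · have := hp.2
    simp at this
  set ψ : Fin N → ℝ := fun i => ∫ τ, Real.exp (-(1 * τ)) ∂(φ i) with hψ
  obtain ⟨m, hm⟩ := Finite.exists_max ψ
  have hψ0 : ∀ i, 0 ≤ ψ i := fun i => integral_nonneg fun τ => (Real.exp_pos _).le
  have hm1 : ψ m < 1 := integral_exp_neg_mul_lt_one (h0 m) one_pos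
  have hn : ∀ n, Integrable (fun ω => Real.exp (-renewalTime T n ω)) P ∧
      ∫ ω, Real.exp (-renewalTime T n ω) ∂P ≤ ψ m ^ n := by
    intro n
    have h1 := h.integral_prod hp.1 (fun i j => Matrix.nonneg_of_mem_rowStochastic hM)
      (f := fun _ τ => Real.exp (-(1 * τ))) (g := fun _ _ => 1)
      (fun i => integrable_exp_neg_mul (h0 i) zero_le_one) (fun _ => measurable_exp_neg_mul 1)
      (fun _ => integrable_const _) (fun _ => measurable_const) n
    have h2 : (fun ω => (∏ k ∈ Finset.range n, Real.exp (-(1 * T k ω))) * 1) =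
        fun ω => Real.exp (-renewalTime T n ω) := by
      funext ω
      rw [← Real.exp_sum, renewalTime]
      simp
    rw [h2] at h1
    refine ⟨h1.1, h1.2.trans_le ?_⟩
    have h3 : ∀ n i, 0 ≤ ((Matrix.of fun i j => ψ i * M i j) ^ n).mulVec (fun _ => 1) i ∧
        ((Matrix.of fun i j => ψ i * M i j) ^ n).mulVec (fun _ => 1) i ≤ ψ m ^ n := by
      intro n
      induction n with
      | zero => simp
      | succ n ih =>
        intro i
        rw [pow_succ', ← Matrix.mulVec_mulVec]
        set v := ((Matrix.of fun i j => ψ i * M i j) ^ n).mulVec (fun _ => 1)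
        simp only [Matrix.mulVec, dotProduct, Matrix.of_apply, mul_assoc, ← Finset.mul_sum]
        have h4 : 0 ≤ ∑ j, M i j * v j := Finset.sum_nonneg fun j _ =>
          mul_nonneg (Matrix.nonneg_of_mem_rowStochastic hM) (ih j).1
        have h5 : ∑ j, M i j * v j ≤ ψ m ^ n := by
          calc ∑ j, M i j * v j ≤ ∑ j, M i j * ψ m ^ n := Finset.sum_le_sum fun j _ =>
                mul_le_mul_of_nonneg_left (ih j).2 (Matrix.nonneg_of_mem_rowStochastic hM)
            _ = ψ m ^ n := by
              rw [← Finset.sum_mul, Matrix.sum_row_of_mem_rowStochastic hM, one_mul]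
        refine ⟨mul_nonneg (hψ0 i) h4, ?_⟩
        rw [pow_succ']
        exact mul_le_mul (hm i) h5 h4 (hψ0 m)
    simp only [dotProduct, integral_const, probReal_univ, smul_eq_mul, mul_one]
    calc _ ≤ ∑ i, p i * ψ m ^ n := Finset.sum_le_sum fun i _ =>
          mul_le_mul_of_nonneg_left (h3 n i).2 (hp.1 i)
      _ = ψ m ^ n := by rw [← Finset.sum_mul, hp.2, one_mul]
  have hfin : ∫⁻ ω, ∑' n, ENNReal.ofReal (Real.exp (-renewalTime T n ω)) ∂P ≠ ⊤ := by
    rw [lintegral_tsum fun n => (hn n).1.aestronglyMeasurable.aemeasurable.ennreal_ofReal]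
    simp_rw [← fun n => ofReal_integral_eq_lintegral_ofReal (hn n).1
      (ae_of_all _ fun _ => (Real.exp_pos _).le)]
    refine ne_top_of_le_ne_top ?_ (ENNReal.tsum_le_tsum fun n =>
      ENNReal.ofReal_le_ofReal (hn n).2)
    rw [← ENNReal.ofReal_tsum_of_nonneg (fun n => pow_nonneg (hψ0 m) n)
      (summable_geometric_of_lt_one (hψ0 m) hm1)]
    exact ENNReal.ofReal_ne_top
  have hmeas : AEMeasurable (fun ω => ∑' n, ENNReal.ofReal (Real.exp (-renewalTime T n ω))) P :=
    AEMeasurable.tsum fun n => (hn n).1.aestronglyMeasurable.aemeasurable.ennreal_ofReal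
  filter_upwards [ae_lt_top' hmeas hfin] with ω hω
  have h1 := ENNReal.tendsto_atTop_zero_of_tsum_ne_top hω.ne
  have h2 : Tendsto (fun n => Real.exp (-renewalTime T n ω)) atTop (𝓝 0) := by
    have := (ENNReal.tendsto_toReal ENNReal.zero_ne_top).comp h1
    simpa [Function.comp_def, ENNReal.toReal_ofReal (Real.exp_pos _).le] using this
  exact tendsto_neg_atBot_iff.1 (Real.tendsto_exp_comp_nhds_zero.1 h2)

/-- The Laplace transform of the exponential functional of the occupation time, through the
solution of the renewal equation. -/
lemma IsMultiStateRenewal.exists_laplace [IsProbabilityMeasure P] (i₀ : Fin N) {s u : ℝ}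
    (hs : 0 < s) (hu : 0 ≤ u)
    (κ ψ : Fin N → ℝ) (hκ : ∀ i, κ i = s + u * if i = i₀ then 1 else 0)
    (hψ : ∀ i, ψ i = ∫ τ, Real.exp (-(κ i * τ)) ∂(φ i)) :
    ∃ y : Fin N → ℝ, (∀ i, 0 ≤ y i ∧ y i ≤ 1 / s) ∧
      (∀ i, y i = (1 - ψ i) / κ i + ψ i * M.mulVec y i) ∧
      ∫ ω, (∫ t in Ioi 0, Real.exp (-(s * t + u * occupationTime J T i₀ t ω))) ∂P =
        ∑ i, p i * y i := by
  have hsκ : ∀ i, s ≤ κ i := fun i => by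
    rw [hκ]; split_ifs <;> simp [hu]
  have hκ0 : ∀ i, 0 < κ i := fun i => hs.trans_le (hsκ i)
  have hψ0 : ∀ i, 0 ≤ ψ i := fun i => by
    rw [hψ]; exact integral_nonneg fun τ => (Real.exp_pos _).le
  have hψ1 : ∀ i, ψ i < 1 := fun i => by
    rw [hψ]; exact integral_exp_neg_mul_lt_one (h0 i) (hκ0 i)
  set K : Matrix (Fin N) (Fin N) ℝ := Matrix.of fun i j => ψ i * M i j with hK
  set d : Fin N → ℝ := fun i => (1 - ψ i) / κ i with hd
  have hd0 : ∀ i, 0 ≤ d i := fun i => div_nonneg (by linarith [hψ1 i]) (hκ0 i).le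
  have hds : ∀ i, d i ≤ (1 - ψ i) / s := fun i =>
    div_le_div_of_nonneg_left (by linarith [hψ1 i]) hs (hsκ i)
  -- Partial sums of the Neumann series of `y = d + K y`. They increase and, because `d i ≤ (1 - ψ
  -- i) / s`, stay below `1 / s`; their limit is the solution sought.
  set Y : ℕ → Fin N → ℝ := fun n => ∑ k ∈ Finset.range n, (K ^ k).mulVec d with hY
  have hKv : ∀ (v : Fin N → ℝ) i, K.mulVec v i = ψ i * M.mulVec v i := fun v i => by
    simp only [hK, Matrix.mulVec, dotProduct, Matrix.of_apply, mul_assoc, Finset.mul_sum]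
  have hYs : ∀ n, Y (n + 1) = d + K.mulVec (Y n) := by
    intro n
    simp only [hY]
    rw [Finset.sum_range_succ', Matrix.mulVec_sum, add_comm]
    simp [Matrix.mulVec_mulVec, pow_succ']
  have hpow : ∀ k i, 0 ≤ (K ^ k).mulVec d i := by
    intro k
    induction k with
    | zero => simpa using hd0
    | succ k ih =>
      intro i
      rw [pow_succ', ← Matrix.mulVec_mulVec, hKv]
      exact mul_nonneg (hψ0 i) (Matrix.nonneg_mulVec_of_mem_rowStochastic hM ih i)
  have hYb : ∀ n i, Y n i ≤ 1 / s := by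
    intro n
    induction n with
    | zero => intro i; simp [hY, hs.le]
    | succ n ih =>
      intro i
      rw [hYs, Pi.add_apply, hKv]
      have h1 : M.mulVec (Y n) i ≤ 1 / s := by
        calc ∑ j, M i j * Y n j ≤ ∑ j, M i j * (1 / s) := Finset.sum_le_sum fun j _ =>
              mul_le_mul_of_nonneg_left (ih j) (Matrix.nonneg_of_mem_rowStochastic hM)
          _ = 1 / s := by
            rw [← Finset.sum_mul, Matrix.sum_row_of_mem_rowStochastic hM, one_mul]
      calc d i + ψ i * M.mulVec (Y n) i ≤ (1 - ψ i) / s + ψ i * (1 / s) :=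
            add_le_add (hds i) (mul_le_mul_of_nonneg_left h1 (hψ0 i))
        _ = 1 / s := by ring
  have hYmono : ∀ i, Monotone fun n => Y n i := fun i => monotone_nat_of_le_succ fun n => by
    simp only [hY, Finset.sum_range_succ, Pi.add_apply]
    linarith [hpow n i]
  have hYlim : ∀ i, Tendsto (fun n => Y n i) atTop (𝓝 (⨆ n, Y n i)) := fun i =>
    tendsto_atTop_ciSup (hYmono i) ⟨1 / s, by rintro _ ⟨n, rfl⟩; exact hYb n i⟩
  set y : Fin N → ℝ := fun i => ⨆ n, Y n i with hy
  refine ⟨y, fun i => ⟨?_, le_of_tendsto' (hYlim i) fun n => hYb n i⟩, fun i => ?_, ?_⟩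
  · refine ge_of_tendsto' (hYlim i) fun n => ?_
    simp only [hY, Finset.sum_apply]
    exact Finset.sum_nonneg fun k _ => hpow k i
  · refine tendsto_nhds_unique ((hYlim i).comp (tendsto_add_atTop_nat 1)) ?_
    have h1 : Tendsto Y atTop (𝓝 y) := tendsto_pi_nhds.2 hYlim
    have h2 : Tendsto (fun n => d i + ψ i * M.mulVec (Y n) i) atTop
        (𝓝 (d i + ψ i * M.mulVec y i)) :=
      ((((continuous_apply i).comp (Continuous.matrix_mulVec continuous_const
        continuous_id)).continuousAt.tendsto.comp h1).const_mul _).const_add _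
    refine h2.congr fun n => ?_
    simp only [Function.comp_apply, hYs, Pi.add_apply, hKv]
  -- `X k` is the contribution of the `k`-th sojourn to the time integral; its mean is the `k`-th
  -- Neumann term averaged over `p`.
  · set X : ℕ → Ω → ℝ := fun k ω =>
      (∏ l ∈ Finset.range k, Real.exp (-((s + u * (if J l ω = i₀ then 1 else 0)) * T l ω))) *
        ((1 - Real.exp (-((s + u * (if J k ω = i₀ then 1 else 0)) * T k ω))) /
          (s + u * (if J k ω = i₀ then 1 else 0))) with hX
    have hXi : ∀ k, Integrable (X k) P ∧ ∫ ω, X k ω ∂P = dotProduct p ((K ^ k).mulVec d) := by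
      intro k
      have h1 := h.integral_prod hp.1 (fun i j => Matrix.nonneg_of_mem_rowStochastic hM)
        (f := fun i τ => Real.exp (-(κ i * τ))) (g := fun i τ => (1 - Real.exp (-(κ i * τ))) / κ i)
        (fun i => integrable_exp_neg_mul (h0 i) (hκ0 i).le) (fun _ => measurable_exp_neg_mul _)
        (fun i => ((integrable_const _).sub
          (integrable_exp_neg_mul (h0 i) (hκ0 i).le)).div_const _)
        (fun _ => (measurable_const.sub (measurable_exp_neg_mul _)).div_const _) k
      have h2 : (fun i => ∫ τ, (1 - Real.exp (-(κ i * τ))) / κ i ∂(φ i)) = d := by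
        funext i
        rw [integral_div, integral_sub (integrable_const _)
          (integrable_exp_neg_mul (h0 i) (hκ0 i).le), ← hψ]
        simp [hd]
      simp_rw [h2, ← hψ, hκ] at h1
      exact h1
    have hlim : Tendsto (fun n => ∫ ω, ∑ k ∈ Finset.range n, X k ω ∂P) atTop
        (𝓝 (∫ ω, (∫ t in Ioi 0, Real.exp (-(s * t + u * occupationTime J T i₀ t ω))) ∂P)) := by
      have hgood : ∀ᵐ ω ∂P, (∀ n, 0 < T n ω) ∧
          Tendsto (fun n => renewalTime T n ω) atTop atTop :=
        (h.ae_wait_pos hp hM h0).and (h.ae_renewalTime_tendsto hp hM h0)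
      have hle : ∀ ω t, 0 ≤ t →
          Real.exp (-(s * t + u * occupationTime J T i₀ t ω)) ≤ Real.exp (-s * t) := by
        intro ω t ht
        have h1 := (occupationTime_sub_mem h.measurable_state h.measurable_wait i₀ ω ht).1
        have h2 : occupationTime J T i₀ 0 ω = 0 := by simp [occupationTime, stateFunctional]
        rw [h2, sub_zero] at h1
        refine Real.exp_le_exp.2 ?_
        nlinarith [mul_nonneg hu h1]
      have hcont : ∀ ω, Continuous fun t =>
          Real.exp (-(s * t + u * occupationTime J T i₀ t ω)) := fun ω =>
        Real.continuous_exp.comp (((continuous_const.mul continuous_id).add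
          (continuous_const.mul (continuous_occupationTime h.measurable_state
            h.measurable_wait i₀ ω))).neg)
      have hint : ∀ ω, IntegrableOn (fun t =>
          Real.exp (-(s * t + u * occupationTime J T i₀ t ω))) (Ioi 0) := fun ω => by
        refine (exp_neg_integrableOn_Ioi 0 hs).mono' (hcont ω).aestronglyMeasurable ?_
        filter_upwards [ae_restrict_mem measurableSet_Ioi] with t ht
        rw [Real.norm_eq_abs, abs_of_pos (Real.exp_pos _)]
        exact hle ω t (le_of_lt ht)
      refine tendsto_integral_of_dominated_convergence (fun _ => 1 / s)
        (fun n => (integrable_finsetSum _ fun k _ => (hXi k).1).aestronglyMeasurable)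
        (integrable_const _) (fun n => ?_) ?_
      · filter_upwards [hgood] with ω hω
        have hS : 0 ≤ renewalTime T n ω := Finset.sum_nonneg fun k _ => (hω.1 k).le
        have h1 := (integral_exp_renewalTime h.measurable_state h.measurable_wait i₀ hω.1 hs hu
          n).2
        simp only [hX]
        rw [← h1, Real.norm_eq_abs, abs_of_nonneg
          (intervalIntegral.integral_nonneg hS fun t _ => (Real.exp_pos _).le),
          intervalIntegral.integral_of_le hS]
        calc _ ≤ ∫ t in Ioi 0, Real.exp (-(s * t + u * occupationTime J T i₀ t ω)) :=
              setIntegral_mono_set (hint ω) (ae_of_all _ fun _ => (Real.exp_pos _).le)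
                Ioc_subset_Ioi_self.eventuallyLE
          _ ≤ ∫ t in Ioi 0, Real.exp (-s * t) :=
              setIntegral_mono_on (hint ω) (exp_neg_integrableOn_Ioi 0 hs) measurableSet_Ioi
                fun t ht => hle ω t (le_of_lt ht)
          _ = 1 / s := by
              rw [integral_exp_mul_Ioi (neg_lt_zero.2 hs)]
              simp
      · filter_upwards [hgood] with ω hω
        have h1 := intervalIntegral_tendsto_integral_Ioi 0 (hint ω) hω.2
        refine h1.congr fun n => ?_
        exact (integral_exp_renewalTime h.measurable_state h.measurable_wait i₀ hω.1 hs hu n).2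
    refine tendsto_nhds_unique hlim ?_
    have h3 : Tendsto (fun n => ∑ i, p i * Y n i) atTop (𝓝 (∑ i, p i * y i)) :=
      tendsto_finsetSum _ fun i _ => (hYlim i).const_mul _
    refine h3.congr fun n => ?_
    rw [integral_finsetSum _ fun k _ => (hXi k).1]
    simp_rw [fun k => (hXi k).2, ← dotProduct_sum]
    rfl

end Expectation

/-! ### Weak convergence on the unit square from moments. -/

section Moments

open unitInterval

/-- On the unit square, convergence of all mixed moments implies weak convergence. -/
lemma tendsto_integral_of_moments {β : Type*} {l : Filter β} {μ : β → Measure (I × I)}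
    [∀ r, IsProbabilityMeasure (μ r)] {μ₀ : Measure (I × I)} [IsProbabilityMeasure μ₀]
    (h : ∀ m n : ℕ, Tendsto (fun r => ∫ x, (x.1 : ℝ) ^ m * (x.2 : ℝ) ^ n ∂(μ r)) l
      (𝓝 (∫ x, (x.1 : ℝ) ^ m * (x.2 : ℝ) ^ n ∂μ₀))) (F : C(I × I, ℝ)) :
    Tendsto (fun r => ∫ x, F x ∂(μ r)) l (𝓝 (∫ x, F x ∂μ₀)) := by
  have hint : ∀ (m : Measure (I × I)) [IsProbabilityMeasure m] (G : C(I × I, ℝ)),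
      Integrable (fun x => G x) m := fun m _ G =>
    G.continuous.integrable_of_hasCompactSupport (HasCompactSupport.of_compactSpace _)
  set X : C(I × I, ℝ) := ⟨fun x => x.1, by fun_prop⟩ with hX
  set Y : C(I × I, ℝ) := ⟨fun x => x.2, by fun_prop⟩ with hY
  have hspan : ∀ G ∈ Algebra.adjoin ℝ {X, Y},
      Tendsto (fun r => ∫ x, G x ∂(μ r)) l (𝓝 (∫ x, G x ∂μ₀)) := by
    intro G hG
    rw [← Subalgebra.mem_toSubmodule, Algebra.adjoin_eq_span] at hG
    induction hG using Submodule.span_induction with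
    | mem G hG =>
      obtain ⟨m, n, rfl⟩ := (Submonoid.mem_closure_pair _ _ _).1 hG
      exact h m n
    | zero => simpa using tendsto_const_nhds
    | add G H _ _ hG hH =>
      simp only [ContinuousMap.add_apply]
      rw [integral_add (hint _ _) (hint _ _)]
      refine (hG.add hH).congr fun r => ?_
      rw [integral_add (hint _ _) (hint _ _)]
    | smul c G _ hG =>
      simp only [ContinuousMap.smul_apply, smul_eq_mul, integral_const_mul]
      exact hG.const_mul c
  have htop : (Algebra.adjoin ℝ {X, Y}).topologicalClosure = ⊤ := by
    refine ContinuousMap.subalgebra_topologicalClosure_eq_top_of_separatesPoints _ ?_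
    intro x y hxy
    by_cases h1 : x.1 = y.1
    · refine ⟨Y, ⟨Y, Algebra.subset_adjoin (by simp), rfl⟩, fun h2 => hxy ?_⟩
      exact Prod.ext h1 (Subtype.ext h2)
    · exact ⟨X, ⟨X, Algebra.subset_adjoin (by simp), rfl⟩, fun h2 => h1 (Subtype.ext h2)⟩
  have hF : F ∈ closure (Algebra.adjoin ℝ {X, Y} : Set C(I × I, ℝ)) := by
    rw [← Subalgebra.topologicalClosure_coe, htop]
    trivial
  -- Integration is `1`-Lipschitz for the sup norm uniformly over probability measures, so
  -- convergence on the dense polynomials extends to `F`.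
  have hdist : ∀ (m : Measure (I × I)) [IsProbabilityMeasure m] (G : C(I × I, ℝ)),
      dist (∫ x, F x ∂m) (∫ x, G x ∂m) ≤ dist F G := fun m _ G => by
    rw [dist_eq_norm, ← integral_sub (hint _ _) (hint _ _)]
    refine (norm_integral_le_of_norm_le_const (C := dist F G)
      (ae_of_all _ fun x => ?_)).trans_eq (by simp)
    rw [← dist_eq_norm]
    exact ContinuousMap.dist_apply_le_dist x
  rw [Metric.tendsto_nhds]
  intro e he
  obtain ⟨G, hG, hFG⟩ := Metric.mem_closure_iff.1 hF (e / 3) (by linarith)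
  filter_upwards [Metric.tendsto_nhds.1 (hspan G hG) (e / 3) (by linarith)] with r hr
  have h1 := dist_triangle4 (∫ x, F x ∂(μ r)) (∫ x, G x ∂(μ r)) (∫ x, G x ∂μ₀) (∫ x, F x ∂μ₀)
  have h2 := hdist (μ r) G
  have h3 := hdist μ₀ G
  rw [dist_comm] at h3
  linarith

end Moments

/-! ### From an exponential time to a deterministic time. -/

section Tauberian

/-- The standard exponential law on the positive half-line. -/
noncomputable def stdExp : Measure ℝ :=
  (volume.restrict (Ioi 0)).withDensity fun t => ENNReal.ofReal (Real.exp (-t))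

lemma integral_stdExp (g : ℝ → ℝ) :
    ∫ t, g t ∂stdExp = ∫ t in Ioi 0, Real.exp (-t) * g t := by
  rw [stdExp, integral_withDensity_eq_integral_toReal_smul (by fun_prop)
    (ae_of_all _ fun _ => ENNReal.ofReal_lt_top)]
  simp [ENNReal.toReal_ofReal (Real.exp_pos _).le]

instance : IsProbabilityMeasure stdExp := by
  constructor
  rw [stdExp, withDensity_apply _ MeasurableSet.univ, Measure.restrict_univ,
    ← ofReal_integral_eq_lintegral_ofReal _ (ae_of_all _ fun _ => (Real.exp_pos _).le),
    integral_exp_neg_Ioi_zero, ENNReal.ofReal_one]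
  simpa [IntegrableOn] using exp_neg_integrableOn_Ioi 0 one_pos

lemma ae_stdExp_pos : ∀ᵐ t ∂stdExp, 0 < t :=
  (withDensity_absolutelyContinuous _ _).ae_le (ae_restrict_mem measurableSet_Ioi)

open unitInterval in
/-- Convergence in law of `A t / t`, for a random nondecreasing `1`-Lipschitz function `A`, follows
from that of Laplace transforms at an independent exponential time. -/
theorem convergesInLaw_of_laplace {Ω : Type*} [MeasurableSpace Ω] {P : Measure Ω}
    [IsProbabilityMeasure P] {A : ℝ → Ω → ℝ} (hAm : ∀ t, Measurable (A t))
    (hA0 : ∀ ω, A 0 ω = 0) (hA : ∀ ω a b, a ≤ b → A b ω - A a ω ∈ Icc 0 (b - a))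
    {ν : Measure ℝ} [IsProbabilityMeasure ν] (hν : ∀ᵐ x ∂ν, x ∈ Icc (0 : ℝ) 1)
    (hL : ∀ m n : ℕ, Tendsto (fun r : ℝ =>
        ∫ ω, (∫ t in Ioi 0, Real.exp (-((1 + m) * t + n * (A (r * t) ω / r)))) ∂P) atTop
      (𝓝 (∫ x, 1 / (1 + m + n * x) ∂ν))) :
    ConvergesInLaw (fun t ω => A t ω / t) P ν := by
  have hAmem : ∀ ω t, 0 ≤ t → A t ω ∈ Icc 0 t := fun ω t ht => by
    simpa [hA0] using hA ω 0 t ht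
  have hAlip : ∀ ω a b, |A b ω - A a ω| ≤ |b - a| := by
    intro ω a b
    rcases le_total a b with h | h
    · rw [abs_of_nonneg (hA ω a b h).1, abs_of_nonneg (sub_nonneg.2 h)]
      exact (hA ω a b h).2
    · rw [abs_sub_comm, abs_sub_comm b, abs_of_nonneg (hA ω b a h).1,
        abs_of_nonneg (sub_nonneg.2 h)]
      exact (hA ω b a h).2
  have hAc : ∀ ω, Continuous fun t => A t ω := fun ω =>
    (LipschitzWith.of_dist_le_mul (K := 1) fun a b => by
      simpa [Real.dist_eq] using hAlip ω b a).continuous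
  have hAj : Measurable fun x : ℝ × Ω => A x.1 x.2 :=
    measurable_uncurry_of_continuous_of_measurable (u := A) hAc hAm
  have hAr : ∀ r : ℝ, Measurable fun x : ℝ × Ω => A (r * x.1) x.2 := fun r =>
    hAj.comp ((measurable_fst.const_mul r).prodMk measurable_snd)
  set pr : ℝ → I := Set.projIcc 0 1 zero_le_one with hpr
  have hprm : Measurable pr := continuous_projIcc.measurable
  have hprexp : ∀ t : ℝ, 0 ≤ t → (pr (Real.exp (-t)) : ℝ) = Real.exp (-t) := fun t ht => by
    rw [hpr, Set.projIcc_of_mem _ ⟨(Real.exp_pos _).le, Real.exp_le_one_iff.2 (by linarith)⟩]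
  -- Exponentials map time and occupation time into a compact square, where monomials integrate to
  -- the transforms in `hL`; the `1` in `1 + m` is the exponential density. The projection `pr` acts
  -- trivially for positive `r` and `t`.
  set Z : ℝ → ℝ × Ω → I × I := fun r x =>
    (pr (Real.exp (-x.1)), pr (Real.exp (-(A (r * x.1) x.2 / r)))) with hZ
  have hZm : ∀ r, Measurable (Z r) := fun r =>
    (hprm.comp (Real.measurable_exp.comp measurable_fst.neg)).prodMk
      (hprm.comp (Real.measurable_exp.comp ((hAr r).div_const r).neg))
  set Z₀ : ℝ × ℝ → I × I := fun x => (pr (Real.exp (-x.1)), pr (Real.exp (-(x.1 * x.2)))) with hZ₀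
  have hZ₀m : Measurable Z₀ :=
    (hprm.comp (Real.measurable_exp.comp measurable_fst.neg)).prodMk
      (hprm.comp (Real.measurable_exp.comp (measurable_fst.mul measurable_snd).neg))
  have haeP : ∀ᵐ x : ℝ × Ω ∂(stdExp.prod P), 0 < x.1 :=
    Measure.quasiMeasurePreserving_fst.ae ae_stdExp_pos
  have haeν : ∀ᵐ x : ℝ × ℝ ∂(stdExp.prod ν), 0 < x.1 ∧ x.2 ∈ Icc (0 : ℝ) 1 :=
    (Measure.quasiMeasurePreserving_fst.ae ae_stdExp_pos).and
      (Measure.quasiMeasurePreserving_snd.ae hν)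
  have hprobr : ∀ r, IsProbabilityMeasure ((stdExp.prod P).map (Z r)) := fun r =>
    Measure.isProbabilityMeasure_map (hZm r).aemeasurable
  have hprob0 : IsProbabilityMeasure ((stdExp.prod ν).map Z₀) :=
    Measure.isProbabilityMeasure_map hZ₀m.aemeasurable
  -- convergence of the law of `Z r`
  have hweak : ∀ F : C(I × I, ℝ), Tendsto (fun r : Ioi (0 : ℝ) => ∫ x, F (Z r x) ∂(stdExp.prod P))
      (comap Subtype.val atTop) (𝓝 (∫ x, F (Z₀ x) ∂(stdExp.prod ν))) := by
    -- The index is restricted to `r > 0` because the moment identity is used for every index.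
    intro F
    have := tendsto_integral_of_moments (l := comap (Subtype.val : Ioi (0 : ℝ) → ℝ) atTop)
      (μ := fun r => (stdExp.prod P).map (Z r)) (μ₀ := (stdExp.prod ν).map Z₀) ?_ F
    · rw [integral_map hZ₀m.aemeasurable F.continuous.aestronglyMeasurable] at this
      refine this.congr fun r => ?_
      rw [integral_map (hZm r).aemeasurable F.continuous.aestronglyMeasurable]
    · intro m n
      have hcont : Continuous fun x : I × I => (x.1 : ℝ) ^ m * (x.2 : ℝ) ^ n := by fun_prop
      have hb : ∀ x : I × I, ‖(x.1 : ℝ) ^ m * (x.2 : ℝ) ^ n‖ ≤ 1 := fun x => by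
        rw [norm_mul, norm_pow, norm_pow, Real.norm_eq_abs, Real.norm_eq_abs,
          abs_of_nonneg x.1.2.1, abs_of_nonneg x.2.2.1]
        exact mul_le_one₀ (pow_le_one₀ x.1.2.1 x.1.2.2) (pow_nonneg x.2.2.1 _)
          (pow_le_one₀ x.2.2.1 x.2.2.2)
      have hlim : ∫ x, (x.1 : ℝ) ^ m * (x.2 : ℝ) ^ n ∂((stdExp.prod ν).map Z₀) =
          ∫ x, 1 / (1 + m + n * x) ∂ν := by
        rw [integral_map hZ₀m.aemeasurable hcont.aestronglyMeasurable, integral_prod_symm]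
        · refine integral_congr_ae ?_
          filter_upwards [hν] with x hx
          have hc : (0 : ℝ) < 1 + m + n * x := by
            have := mul_nonneg (Nat.cast_nonneg (α := ℝ) n) hx.1
            positivity
          rw [integral_stdExp]
          have h1 : ∀ t ∈ Ioi (0 : ℝ), Real.exp (-t) *
              (((Z₀ (t, x)).1 : ℝ) ^ m * ((Z₀ (t, x)).2 : ℝ) ^ n) =
              Real.exp (-(1 + m + n * x) * t) := by
            intro t ht
            have ht' : 0 ≤ t := le_of_lt ht
            simp only [hZ₀]
            rw [hprexp _ ht', hprexp _ (mul_nonneg ht' hx.1), ← Real.exp_nat_mul,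
              ← Real.exp_nat_mul, ← Real.exp_add, ← Real.exp_add]
            congr 1; ring
          rw [setIntegral_congr_fun measurableSet_Ioi h1, integral_exp_mul_Ioi (by linarith),
            mul_zero, Real.exp_zero, neg_div_neg_eq]
        · exact (integrable_const (1 : ℝ)).mono' (hcont.measurable.comp hZ₀m).aestronglyMeasurable
            (ae_of_all _ fun x => hb _)
      rw [hlim]
      refine ((hL m n).comp tendsto_comap).congr fun r => ?_
      have hr : (0 : ℝ) < r := r.2
      rw [integral_map (hZm r).aemeasurable hcont.aestronglyMeasurable, integral_prod_symm]
      · refine integral_congr_ae (ae_of_all _ fun ω => ?_)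
        simp only
        rw [integral_stdExp]
        refine setIntegral_congr_fun measurableSet_Ioi fun t ht => ?_
        have ht' : 0 ≤ t := le_of_lt ht
        have hA' := (hAmem ω (r * t) (mul_nonneg hr.le ht')).1
        simp only [hZ]
        rw [hprexp _ ht', hprexp _ (div_nonneg hA' hr.le), ← Real.exp_nat_mul,
          ← Real.exp_nat_mul, ← Real.exp_add, ← Real.exp_add]
        congr 1; ring
      · exact (integrable_const (1 : ℝ)).mono' (hcont.measurable.comp (hZm r)).aestronglyMeasurable
          (ae_of_all _ fun x => hb _)
  refine ⟨inferInstance, fun t => ((hAm t).div_const t).aemeasurable, aemeasurable_id, ?_⟩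
  refine tendsto_iff_forall_lipschitz_integral_tendsto.2 ?_
  rintro f ⟨C, hC⟩ ⟨L, hf⟩
  have hfc := hf.continuous
  have hfb : ∀ x, ‖f x‖ ≤ ‖f 0‖ + C := fun x => by
    have h1 := hC x 0
    rw [dist_eq_norm] at h1
    have h2 := norm_le_insert' (f x) (f 0)
    linarith
  simp only [ProbabilityMeasure.coe_mk, Measure.map_id]
  simp_rw [fun t : ℝ => integral_map (μ := P) ((hAm t).div_const t).aemeasurable
    hfc.aestronglyMeasurable]
  rw [Metric.tendsto_nhds]
  intro e he
  -- For `|t - 1| < δ ≤ 1 / 2`, the ratios `A (r t) / (r t)` and `A r / r` will differ by at most `4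
  -- δ`.
  obtain ⟨δ, hδ0, hδ1, hδL⟩ : ∃ δ : ℝ, 0 < δ ∧ δ ≤ 1 / 2 ∧ L * (4 * δ) ≤ e / 2 := by
    refine ⟨min (1 / 2) (e / (8 * (L + 1))), by positivity, min_le_left _ _, ?_⟩
    have h1 : min (1 / 2) (e / (8 * (L + 1))) ≤ e / (8 * ((L : ℝ) + 1)) := min_le_right _ _
    rw [le_div_iff₀ (by positivity)] at h1
    have h2 : 0 < min (1 / 2) (e / (8 * ((L : ℝ) + 1))) := by positivity
    nlinarith
  -- A tent around `t = 1`, which confines the exponential time to where it is nearly deterministic.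
  set η : ℝ → ℝ := fun t => max 0 (δ - |t - 1|) with hη
  have hηc : Continuous η := by fun_prop
  have hη0 : ∀ t, 0 ≤ η t := fun t => le_max_left _ _
  have hηb : ∀ t, ‖η t‖ ≤ δ := fun t => by
    rw [Real.norm_eq_abs, abs_of_nonneg (hη0 t)]
    exact max_le hδ0.le (by linarith [abs_nonneg (t - 1)])
  have hηsupp : ∀ t, η t ≠ 0 → |t - 1| < δ := fun t ht => by
    by_contra hneg
    exact ht (max_eq_left (by linarith [not_lt.1 hneg]))
  have hηi : Integrable η stdExp :=
    (integrable_const δ).mono' hηc.aestronglyMeasurable (ae_of_all _ hηb)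
  set c : ℝ := ∫ t, η t ∂stdExp with hc
  have hc0 : 0 < c := by
    rw [hc, integral_stdExp]
    refine (setIntegral_pos_iff_support_of_nonneg_ae
      (ae_of_all _ fun t => mul_nonneg (Real.exp_pos _).le (hη0 t)) ?_).2 ?_
    · refine (exp_neg_integrableOn_Ioi 0 one_pos).mono' (f := fun t => Real.exp (-t) * η t)
        (g := fun t => Real.exp (-1 * t)) ?_ (ae_of_all _ fun t => ?_)
      · exact ((Real.continuous_exp.comp continuous_neg).mul hηc).aestronglyMeasurable
      · rw [norm_mul, Real.norm_eq_abs, abs_of_pos (Real.exp_pos _), neg_one_mul]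
        exact mul_le_of_le_one_right (Real.exp_pos _).le ((hηb t).trans (by linarith))
    · refine lt_of_lt_of_le ?_ (measure_mono (s := Ioo (1 - δ) (1 + δ)) fun t ht => ?_)
      · rw [Real.volume_Ioo, ENNReal.ofReal_pos]; linarith
      · refine ⟨?_, mem_Ioi.2 (by linarith [ht.1])⟩
        have h1 : |t - 1| < δ := abs_lt.2 ⟨by linarith [ht.1], by linarith [ht.2]⟩
        have h2 : 0 < η t := lt_max_of_lt_right (by linarith)
        exact (mul_pos (Real.exp_pos _) h2).ne'
  -- the test function on the square
  set lg : I → ℝ := fun x => -Real.log (max x (Real.exp (-3))) with hlg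
  have hlgc : Continuous lg := by
    refine (Continuous.log (by fun_prop) fun x => ?_).neg
    exact (lt_max_of_lt_right (Real.exp_pos _)).ne'
  have hlgexp : ∀ t : ℝ, 0 ≤ t → lg (pr (Real.exp (-t))) = min t 3 := fun t ht => by
    simp only [hlg]
    rw [hprexp t ht, ← Real.exp_monotone.map_max, Real.log_exp, max_neg_neg, neg_neg]
  -- `lg` recovers an exponent from its exponential, truncated at `3`. That truncation and the floor
  -- `1 / 2` of the denominator only ensure continuity: where `η t ≠ 0` one has `1 / 2 < t < 3 / 2`,
  -- and neither is active.
  set F : C(I × I, ℝ) := ⟨fun x => η (lg x.1) * f (lg x.2 / max (lg x.1) (1 / 2)), by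
    refine (hηc.comp (hlgc.comp continuous_fst)).mul (hfc.comp ?_)
    refine (hlgc.comp continuous_snd).div₀ ((hlgc.comp continuous_fst).max continuous_const) ?_
    intro x
    exact (lt_max_of_lt_right (by norm_num)).ne'⟩ with hF
  have hFval : ∀ t x : ℝ, 0 < t → x ∈ Icc (0 : ℝ) 1 →
      F (pr (Real.exp (-t)), pr (Real.exp (-(t * x)))) = η t * f x := by
    intro t x ht hx
    simp only [hF, ContinuousMap.coe_mk]
    rw [hlgexp t ht.le, hlgexp _ (mul_nonneg ht.le hx.1)]
    by_cases h1 : η t = 0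
    · have h2 : η (min t 3) = 0 := by
        rcases le_total t 3 with h3 | h3
        · rwa [min_eq_left h3]
        · rw [min_eq_right h3]
          refine max_eq_left ?_
          norm_num; linarith
      rw [h1, h2, zero_mul, zero_mul]
    · have h2 := abs_lt.1 (hηsupp t h1)
      have h3 : t * x ≤ 3 := by nlinarith [hx.1, hx.2]
      rw [min_eq_left (by linarith), min_eq_left h3, max_eq_left (by linarith),
        mul_div_cancel_left₀ _ ht.ne']
  have hFlim : ∫ x, F (Z₀ x) ∂(stdExp.prod ν) = c * ∫ x, f x ∂ν := by
    rw [hc, ← integral_prod_mul]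
    refine integral_congr_ae ?_
    filter_upwards [haeν] with x hx
    exact hFval x.1 x.2 hx.1 hx.2
  have hFr : ∀ r : ℝ, 0 < r → ∫ x, F (Z r x) ∂(stdExp.prod P) =
      ∫ x : ℝ × Ω, η x.1 * f (A (r * x.1) x.2 / (r * x.1)) ∂(stdExp.prod P) := by
    intro r hr
    refine integral_congr_ae ?_
    filter_upwards [haeP] with x hx
    have hrx : 0 < r * x.1 := mul_pos hr hx
    have h1 := hAmem x.2 (r * x.1) hrx.le
    have h2 : A (r * x.1) x.2 / r = x.1 * (A (r * x.1) x.2 / (r * x.1)) := by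
      field_simp
    simp only [hZ]
    rw [h2]
    exact hFval x.1 _ hx ⟨div_nonneg h1.1 hrx.le, div_le_one_of_le₀ h1.2 hrx.le⟩
  have hclose : ∀ r : ℝ, 0 < r → |∫ x, F (Z r x) ∂(stdExp.prod P) - c * ∫ ω, f (A r ω / r) ∂P| ≤
      c * (e / 2) := by
    intro r hr
    have hi1 : Integrable (fun x : ℝ × Ω => η x.1 * f (A (r * x.1) x.2 / (r * x.1)))
        (stdExp.prod P) := by
      refine (integrable_const (δ * (‖f 0‖ + C))).mono' ((hηc.measurable.comp
        measurable_fst).mul (hfc.measurable.comp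
          ((hAr r).div (measurable_fst.const_mul r)))).aestronglyMeasurable
        (ae_of_all _ fun x => ?_)
      rw [norm_mul]
      exact mul_le_mul (hηb _) (hfb _) (norm_nonneg _) hδ0.le
    have hi2 : Integrable (fun x : ℝ × Ω => η x.1 * f (A r x.2 / r)) (stdExp.prod P) := by
      refine (integrable_const (δ * (‖f 0‖ + C))).mono' ((hηc.measurable.comp
        measurable_fst).mul (hfc.measurable.comp
          (((hAm r).comp measurable_snd).div_const r))).aestronglyMeasurable
        (ae_of_all _ fun x => ?_)
      rw [norm_mul]
      exact mul_le_mul (hηb _) (hfb _) (norm_nonneg _) hδ0.le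
    rw [hFr r hr, hc, ← integral_prod_mul (μ := stdExp) (ν := P) η (fun ω => f (A r ω / r)),
      ← integral_sub hi1 hi2, ← Real.norm_eq_abs]
    have hi3 : Integrable (fun x : ℝ × Ω => η x.1 * (e / 2)) (stdExp.prod P) :=
      (hηi.mul_prod (integrable_const (e / 2)))
    refine (norm_integral_le_of_norm_le hi3 ?_).trans_eq ?_
    · filter_upwards [haeP] with x hx
      rw [← mul_sub, norm_mul, Real.norm_eq_abs, abs_of_nonneg (hη0 _)]
      by_cases h1 : η x.1 = 0
      · rw [h1]; simp
      · refine mul_le_mul_of_nonneg_left ?_ (hη0 _)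
        have h2 := hηsupp _ h1
        have h3 := abs_lt.1 h2
        have h4 : 1 / 2 ≤ x.1 := by linarith
        rw [← dist_eq_norm]
        refine (hf.dist_le_mul _ _).trans (le_trans ?_ hδL)
        refine mul_le_mul_of_nonneg_left ?_ L.2
        rw [Real.dist_eq]
        -- The changes of numerator and denominator are separated; each costs at most `r * |x.1 -
        -- 1|`.
        have h5 : A (r * x.1) x.2 / (r * x.1) - A r x.2 / r =
            ((A (r * x.1) x.2 - A r x.2) + A r x.2 * (1 - x.1)) / (r * x.1) := by
          field_simp
          ring
        have hrx : 0 < r * x.1 := mul_pos hr hx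
        rw [h5, abs_div, abs_of_pos hrx, div_le_iff₀ hrx]
        have h6 := hAlip x.2 r (r * x.1)
        have h7 : |r * x.1 - r| = r * |x.1 - 1| := by
          rw [← mul_sub_one, abs_mul, abs_of_pos hr]
        have h8 := hAmem x.2 r hr.le
        calc _ ≤ |A (r * x.1) x.2 - A r x.2| + |A r x.2 * (1 - x.1)| := abs_add_le _ _
          _ ≤ r * |x.1 - 1| + r * |x.1 - 1| := by
            refine add_le_add (h6.trans_eq h7) ?_
            rw [abs_mul, abs_of_nonneg h8.1, abs_sub_comm]
            exact mul_le_mul_of_nonneg_right h8.2 (abs_nonneg _)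
          _ ≤ 2 * r * δ := by nlinarith
          _ ≤ 4 * δ * (r * x.1) := by nlinarith [mul_pos hr hδ0]
    · exact integral_prod_mul (μ := stdExp) (ν := P) η (fun _ => e / 2) |>.trans (by simp)
  have hev := Metric.tendsto_nhds.1 (hweak F) (c * (e / 2)) (by positivity)
  rw [eventually_comap] at hev
  filter_upwards [hev, eventually_gt_atTop 0] with r hr hr0
  have h1 := hr ⟨r, hr0⟩ rfl
  rw [hFlim, Real.dist_eq] at h1
  have h2 := hclose r hr0
  rw [abs_sub_comm] at h2
  have h3 : |c * ∫ ω, f (A r ω / r) ∂P - c * ∫ x, f x ∂ν| < c * e := by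
    refine (abs_sub_le _ (∫ x, F (Z r x) ∂(stdExp.prod P)) _).trans_lt ?_
    dsimp only at h1
    linarith
  rw [← mul_sub, abs_mul, abs_of_pos hc0] at h3
  rw [Real.dist_eq]
  exact lt_of_mul_lt_mul_left h3 hc0.le

end Tauberian

/-! ### Contour integration on a horizontal strip. -/

section Strip

open Complex

/-- A limit along `comap re l` is uniform in the imaginary part, and the vertical side has length
`2π`. -/
lemma tendsto_intervalIntegral_vertical {H : ℂ → ℂ} {h : ℂ} {l : Filter ℝ}
    (hd : ContinuousOn H {z | |z.im| ≤ Real.pi}) (hl : Tendsto H (comap re l) (𝓝 h)) :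
    Tendsto (fun R : ℝ => ∫ y in (-Real.pi)..Real.pi, H (R + y * I)) l
      (𝓝 (2 * Real.pi * h)) := by
  have hpi := Real.pi_pos
  rw [Metric.tendsto_nhds]
  intro e he
  have h1 := Metric.tendsto_nhds.1 hl (e / (4 * Real.pi)) (by positivity)
  rw [eventually_comap] at h1
  filter_upwards [h1] with R hR
  have hc : ContinuousOn (fun y : ℝ => H (R + y * I)) (uIcc (-Real.pi) Real.pi) := by
    refine hd.comp (by fun_prop) fun y hy => ?_
    rw [uIcc_of_le (by linarith)] at hy
    simpa [abs_le] using hy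
  have h2 : (2 * Real.pi * h : ℂ) = ∫ y in (-Real.pi)..Real.pi, h := by
    rw [intervalIntegral.integral_const, real_smul]
    push_cast
    ring
  rw [dist_eq_norm, h2, ← intervalIntegral.integral_sub hc.intervalIntegrable
    intervalIntegrable_const]
  refine (intervalIntegral.norm_integral_le_of_norm_le_const (C := e / (4 * Real.pi))
    fun y _ => ?_).trans_lt ?_
  · rw [← dist_eq_norm]
    exact (hR _ (by simp)).le
  · rw [sub_neg_eq_add, abs_of_pos (by linarith)]
    field_simp
    linarith

/-- Cauchy's theorem on a horizontal strip, for a function with limits at both ends. -/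
lemma tendsto_integral_strip_jump {H : ℂ → ℂ} {h₁ h₂ : ℂ}
    (hd : DifferentiableOn ℂ H {z | |z.im| ≤ Real.pi})
    (hbot : Tendsto H (comap re atBot) (𝓝 h₁)) (htop : Tendsto H (comap re atTop) (𝓝 h₂)) :
    Tendsto (fun R : ℝ => ∫ x in (-R)..R, (H (x - Real.pi * I) - H (x + Real.pi * I))) atTop
      (𝓝 (2 * Real.pi * I * (h₁ - h₂))) := by
  have hpi := Real.pi_pos
  have h1 := (tendsto_intervalIntegral_vertical hd.continuousOn hbot).comp tendsto_neg_atTop_atBot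
  have h2 := tendsto_intervalIntegral_vertical hd.continuousOn htop
  have h3 := (h1.const_mul I).sub (h2.const_mul I)
  have h4 : I * (2 * Real.pi * h₁) - I * (2 * Real.pi * h₂) = 2 * Real.pi * I * (h₁ - h₂) := by
    ring
  rw [h4] at h3
  refine h3.congr' ?_
  filter_upwards [eventually_gt_atTop 0] with R hR
  have h5 := integral_boundary_rect_eq_zero_of_differentiableOn H (-R - Real.pi * I)
    (R + Real.pi * I) (hd.mono fun z hz => ?_)
  · have hi : ∀ s : ℝ, |s| = Real.pi →
        IntervalIntegrable (fun x : ℝ => H (x + s * I)) volume (-R) R := fun s hs => by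
      refine ContinuousOn.intervalIntegrable (hd.continuousOn.comp (by fun_prop) fun x _ => ?_)
      simp [hs]
    have h6 : ∀ x : ℝ, (x : ℂ) - Real.pi * I = x + (-Real.pi : ℝ) * I := fun x => by
      push_cast; ring
    simp_rw [h6]
    rw [intervalIntegral.integral_sub (hi _ (by rw [abs_neg, abs_of_pos hpi]))
      (hi _ (abs_of_pos hpi))]
    simp only [sub_re, neg_re, ofReal_re, mul_re, I_re, mul_zero, ofReal_im, I_im, mul_one,
      sub_self, sub_zero, sub_im, neg_im, mul_im, add_re, add_zero, add_im, zero_add, neg_zero,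
      zero_sub, smul_eq_mul] at h5
    simp only [Function.comp_apply]
    linear_combination -h5
  · have h6 := hz.2
    simp only [mem_preimage, sub_im, neg_im, ofReal_im, mul_im, ofReal_re, I_im, mul_one, I_re,
      mul_zero, add_zero, neg_zero, zero_sub, add_im, zero_add] at h6
    rw [uIcc_of_le (by linarith)] at h6
    exact abs_le.2 h6

variable {a u v : ℝ}

/-- At a zero, the imaginary part forces `sin (a * z.im) = 0`, hence `a * z.im = 0` by the bound;
the real part is then positive. -/
lemma add_mul_exp_ne_zero (hu : 0 < u) (hv : 0 < v) {z : ℂ}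
    (hz : |a * z.im| < Real.pi) : (u : ℂ) + v * exp (a * z) ≠ 0 := by
  intro h
  have hre := congrArg re h
  have him := congrArg im h
  simp only [add_re, ofReal_re, mul_re, ofReal_im, exp_re, exp_im, mul_im, zero_mul, sub_zero,
    zero_re, add_im, zero_im, zero_add, add_zero] at hre him
  have h1 : Real.sin (a * z.im) = 0 := by
    rcases mul_eq_zero.1 him with h1 | h1
    · exact absurd h1 hv.ne'
    · exact (mul_eq_zero.1 h1).resolve_left (Real.exp_pos _).ne'
  have h2 : a * z.im = 0 :=
    (Real.sin_eq_zero_iff_of_lt_of_lt (abs_lt.1 hz).1 (abs_lt.1 hz).2).1 h1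
  rw [h2, Real.cos_zero] at hre
  have := mul_pos hv (Real.exp_pos (a * z.re))
  linarith

/-- The function whose jump across the strip is the density of the limit law. -/
noncomputable def stripFun (a u v : ℝ) (z : ℂ) : ℂ := u / (u + v * exp (a * z))

lemma differentiableOn_stripFun (ha : 0 < a) (hu : 0 < u) (hv : 0 < v) :
    DifferentiableOn ℂ (stripFun a u v) {z | |z.im| < Real.pi / a} := by
  intro z hz
  refine DifferentiableAt.differentiableWithinAt ?_
  have h1 : (u : ℂ) + v * exp (a * z) ≠ 0 := by
    refine add_mul_exp_ne_zero hu hv ?_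
    rw [abs_mul, abs_of_pos ha]
    rw [mem_ofPred_eq, lt_div_iff₀ ha] at hz
    linarith
  unfold stripFun
  fun_prop (disch := exact h1)

lemma tendsto_ofReal_mul_comap_re {l : Filter ℝ} (h : Tendsto (fun x => a * x) l l) :
    Tendsto (fun z : ℂ => (a : ℂ) * z) (comap re l) (comap re l) := by
  rw [tendsto_comap_iff]
  refine (h.comp tendsto_comap).congr fun z => ?_
  simp

lemma stripFun_tendsto_atTop (ha : 0 < a) (hv : 0 < v) :
    Tendsto (stripFun a u v) (comap re atTop) (𝓝 0) := by
  have h1 : Tendsto (fun z : ℂ => exp (a * z)) (comap re atTop) (Bornology.cobounded ℂ) :=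
    tendsto_exp_comap_re_atTop.comp (tendsto_ofReal_mul_comap_re (tendsto_id.const_mul_atTop ha))
  have h2 : Tendsto (fun z : ℂ => (u : ℂ) + v * exp (a * z)) (comap re atTop)
      (Bornology.cobounded ℂ) := by
    rw [← tendsto_norm_atTop_iff_cobounded] at h1 ⊢
    have h3 : Tendsto (fun z : ℂ => v * ‖exp (a * z)‖ - ‖(u : ℂ)‖) (comap re atTop) atTop :=
      tendsto_atTop_add_const_right _ _ (h1.const_mul_atTop hv)
    refine tendsto_atTop_mono (fun z => ?_) h3
    have h4 := norm_sub_le ((u : ℂ) + v * exp (a * z)) u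
    rw [add_sub_cancel_left, norm_mul, norm_real, Real.norm_eq_abs, abs_of_pos hv] at h4
    linarith
  have h3 := ((tendsto_inv₀_cobounded (α := ℂ)).comp h2).const_mul (u : ℂ)
  rw [mul_zero] at h3
  exact h3

lemma stripFun_tendsto_atBot (ha : 0 < a) (hu : 0 < u) :
    Tendsto (stripFun a u v) (comap re atBot) (𝓝 1) := by
  have h1 : Tendsto (fun z : ℂ => exp (a * z)) (comap re atBot) (𝓝 0) :=
    tendsto_exp_comap_re_atBot.comp (tendsto_ofReal_mul_comap_re (tendsto_id.const_mul_atBot ha))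
  have hu' : (u : ℂ) ≠ 0 := ofReal_ne_zero.2 hu.ne'
  have h2 : Tendsto (stripFun a u v) (comap re atBot) (𝓝 ((u : ℂ) / (u + v * 0))) :=
    tendsto_const_nhds.div ((h1.const_mul (v : ℂ)).const_add (u : ℂ)) (by simpa using hu')
  simpa [hu'] using h2

/-- The limit density in the logarithmic odds coordinate. -/
noncomputable def logDensity (a u v x : ℝ) : ℝ :=
  Real.sin (Real.pi * a) / Real.pi * (u * v * Real.exp (a * x) /
    (v ^ 2 * Real.exp (a * x) ^ 2 + u ^ 2 +
      2 * u * v * Real.cos (a * Real.pi) * Real.exp (a * x)))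

/-- The expression is `(v E - u)² + 2 u v E (1 + cos (a π))`, and `a < 1` makes the last factor
positive. -/
lemma logDensity_denom_pos (ha0 : 0 < a) (ha1 : a < 1) (hv : 0 < v) {E : ℝ}
    (hu : 0 < u) (hE : 0 < E) :
    0 < v ^ 2 * E ^ 2 + u ^ 2 + 2 * u * v * Real.cos (a * Real.pi) * E := by
  have h1 : -1 < Real.cos (a * Real.pi) := by
    rw [← Real.cos_pi]
    exact Real.cos_lt_cos_of_nonneg_of_le_pi (by positivity) le_rfl
      (by nlinarith [Real.pi_pos])
  have h2 : 0 < 2 * (u * v * E) := by positivity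
  nlinarith [mul_pos h2 (show 0 < 1 + Real.cos (a * Real.pi) by linarith),
    sq_nonneg (v * E - u)]

lemma logDensity_nonneg (ha0 : 0 < a) (ha1 : a < 1) (hu : 0 < u) (hv : 0 < v) (x : ℝ) :
    0 ≤ logDensity a u v x := by
  have h1 := logDensity_denom_pos ha0 ha1 hv hu (Real.exp_pos (a * x))
  have h2 : 0 ≤ Real.sin (Real.pi * a) :=
    Real.sin_nonneg_of_nonneg_of_le_pi (by positivity) (by nlinarith [Real.pi_pos])
  have := Real.pi_pos
  unfold logDensity
  positivity

lemma continuous_logDensity (ha0 : 0 < a) (ha1 : a < 1) (hu : 0 < u) (hv : 0 < v) :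
    Continuous (logDensity a u v) := by
  unfold logDensity
  refine continuous_const.mul (Continuous.div (by fun_prop) (by fun_prop) fun x => ?_)
  exact (logDensity_denom_pos ha0 ha1 hv hu (Real.exp_pos (a * x))).ne'

/-- On the two edges the denominators are the conjugates `u + v E exp(∓ i a π)` with `E = exp (a
x)`. Their product is the denominator of `logDensity` and their difference produces `2 i sin (a π)`.
-/
lemma stripFun_jump (ha0 : 0 < a) (ha1 : a < 1) (hu : 0 < u) (hv : 0 < v) (x : ℝ) :
    stripFun a u v (x - Real.pi * I) - stripFun a u v (x + Real.pi * I) =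
      2 * Real.pi * I * logDensity a u v x := by
  have hpi := Real.pi_pos
  have hlt : a * Real.pi < Real.pi := by nlinarith
  have h1 : (u : ℂ) + v * exp (a * (x - Real.pi * I)) ≠ 0 := by
    refine add_mul_exp_ne_zero hu hv ?_
    simpa [abs_mul, abs_of_pos ha0, abs_of_pos hpi] using hlt
  have h2 : (u : ℂ) + v * exp (a * (x + Real.pi * I)) ≠ 0 := by
    refine add_mul_exp_ne_zero hu hv ?_
    simpa [abs_mul, abs_of_pos ha0, abs_of_pos hpi] using hlt
  have h3 : (v ^ 2 * exp (a * x) ^ 2 + u ^ 2 + 2 * u * v * cos (a * Real.pi) * exp (a * x) : ℂ)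
      ≠ 0 := by
    have := (logDensity_denom_pos ha0 ha1 hv hu (Real.exp_pos (a * x))).ne'
    exact_mod_cast this
  have hpi' : (Real.pi : ℂ) ≠ 0 := ofReal_ne_zero.2 hpi.ne'
  have e1 : exp (a * (x - Real.pi * I)) =
      exp (a * x) * (cos (a * Real.pi) - sin (a * Real.pi) * I) := by
    rw [show (a : ℂ) * (x - Real.pi * I) = a * x + -(a * Real.pi) * I by ring, exp_add,
      exp_mul_I, cos_neg, sin_neg]
    ring
  have e2 : exp (a * (x + Real.pi * I)) =
      exp (a * x) * (cos (a * Real.pi) + sin (a * Real.pi) * I) := by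
    rw [show (a : ℂ) * (x + Real.pi * I) = a * x + (a * Real.pi) * I by ring, exp_add,
      exp_mul_I]
  have hcs := Complex.sin_sq_add_cos_sq (a * Real.pi)
  rw [e1] at h1
  rw [e2] at h2
  unfold stripFun logDensity
  rw [e1, e2, mul_comm Real.pi a]
  push_cast
  set c := cos (a * Real.pi : ℂ)
  set s := sin (a * Real.pi : ℂ)
  set E := exp (a * x : ℂ)
  have hprod : (u + v * (E * (c - s * I))) * (u + v * (E * (c + s * I))) =
      v ^ 2 * E ^ 2 + u ^ 2 + 2 * u * v * c * E := by
    linear_combination (v ^ 2 * E ^ 2 : ℂ) * hcs - (v ^ 2 * E ^ 2 * s ^ 2 : ℂ) * I_sq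
  rw [div_sub_div _ _ h1 h2, hprod]
  field_simp
  ring

lemma exp_sub_pi_mul_I (x : ℝ) : exp (x - Real.pi * I) = -exp x := by
  rw [exp_sub, exp_pi_mul_I, div_neg, div_one]

lemma exp_add_pi_mul_I (x : ℝ) : exp (x + Real.pi * I) = -exp x := by
  rw [exp_add, exp_pi_mul_I, mul_neg_one]

/-- Other solutions of `exp z = exp c` differ from `c` by nonzero multiples of `2πi`, which the
strip excludes; at `c` itself the value is a derivative. -/
lemma dslope_exp_ne_zero (c : ℝ) {z : ℂ} (hz : |z.im| < 2 * Real.pi) :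
    dslope exp (c : ℂ) z ≠ 0 := by
  by_cases h : z = c
  · rw [h, dslope_same, Complex.deriv_exp]
    exact exp_ne_zero _
  · rw [dslope_of_ne _ h, slope_def_field]
    refine div_ne_zero (fun h1 => h ?_) (sub_ne_zero.2 h)
    obtain ⟨n, hn⟩ := exp_eq_exp_iff_exists_int.1 (sub_eq_zero.1 h1)
    have h2 := congrArg im hn
    simp at h2
    rw [h2, abs_mul, abs_of_pos (by positivity : 0 < 2 * Real.pi)] at hz
    have h3 : |(n : ℝ)| < 1 := by
      by_contra hneg
      nlinarith [Real.pi_pos]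
    have h4 : n = 0 := Int.abs_lt_one_iff.1 (by exact_mod_cast h3)
    simpa [h4] using hn

/-- The limits of integrals computed by the jump of a holomorphic function on the strip. -/
lemma integral_of_jump {H : ℂ → ℂ} {h₁ h₂ : ℂ} {κ : ℝ → ℝ} {k : ℝ}
    (hd : DifferentiableOn ℂ H {z | |z.im| ≤ Real.pi})
    (hbot : Tendsto H (comap re atBot) (𝓝 h₁)) (htop : Tendsto H (comap re atTop) (𝓝 h₂))
    (hκ : ∀ x : ℝ, H (x - Real.pi * I) - H (x + Real.pi * I) = 2 * Real.pi * I * κ x)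
    (hk : h₁ - h₂ = k) (hκ0 : ∀ x, 0 ≤ κ x) (hκc : Continuous κ) :
    Integrable κ ∧ ∫ x, κ x = k := by
  have h1 := tendsto_integral_strip_jump hd hbot htop
  have hne : (2 * Real.pi * I : ℂ) ≠ 0 := by
    simp [Real.pi_pos.ne']
  have h2 : Tendsto (fun R : ℝ => ∫ x in (-R)..R, κ x) atTop (𝓝 k) := by
    have h3 := h1.const_mul (2 * Real.pi * I : ℂ)⁻¹
    rw [← mul_assoc, inv_mul_cancel₀ hne, one_mul, hk] at h3
    have h4 := (continuous_re.tendsto _).comp h3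
    refine h4.congr fun R => ?_
    simp_rw [Function.comp_apply, hκ, intervalIntegral.integral_const_mul]
    rw [← mul_assoc, inv_mul_cancel₀ hne, one_mul, intervalIntegral.integral_ofReal, ofReal_re]
  have hint : Integrable κ := by
    refine integrable_of_intervalIntegral_norm_tendsto (l := atTop) (a := fun R : ℝ => -R)
      (b := fun R => R) k (fun R => ?_) tendsto_neg_atTop_atBot tendsto_id ?_
    · exact hκc.integrableOn_Icc.mono_set Ioc_subset_Icc_self
    · simpa only [Real.norm_eq_abs, abs_of_nonneg (hκ0 _)] using h2
  exact ⟨hint, tendsto_nhds_unique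
    (intervalIntegral_tendsto_integral hint tendsto_neg_atTop_atBot tendsto_id) h2⟩

/-- The poles of `stripFun` nearest the real axis have `|Im z| = π / a`; the condition `a < 1` keeps
them off the closed strip. -/
lemma strip_subset (ha0 : 0 < a) (ha1 : a < 1) :
    {z : ℂ | |z.im| ≤ Real.pi} ⊆ {z | |z.im| < Real.pi / a} := fun z hz => by
  rw [mem_ofPred_eq] at hz ⊢
  rw [lt_div_iff₀ ha0]
  nlinarith [Real.pi_pos, abs_nonneg z.im]

lemma integral_logDensity (ha0 : 0 < a) (ha1 : a < 1) (hu : 0 < u) (hv : 0 < v) :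
    Integrable (logDensity a u v) ∧ ∫ x, logDensity a u v x = 1 :=
  integral_of_jump ((differentiableOn_stripFun ha0 hu hv).mono (strip_subset ha0 ha1))
    (stripFun_tendsto_atBot ha0 hu) (stripFun_tendsto_atTop ha0 hv)
    (stripFun_jump ha0 ha1 hu hv) (by simp) (logDensity_nonneg ha0 ha1 hu hv)
    (continuous_logDensity ha0 ha1 hu hv)

/-- On both edges `exp z = -exp x`, so `exp z / (exp z - exp c)` restricts to the kernel. Its pole
at `c` is cancelled by multiplying with `g z - g c` instead of `g z`, where `g` is `stripFun a u v`.
Subtracting the constant leaves the jump of `g` unchanged but moves the limit at `+∞` to `-g c`;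
with limit `0` at `-∞`, the integral is `g c`. -/
lemma integral_logDensity_mul (ha0 : 0 < a) (ha1 : a < 1) (hu : 0 < u) (hv : 0 < v) (c : ℝ) :
    Integrable (fun x => logDensity a u v x * (Real.exp x / (Real.exp x + Real.exp c))) ∧
    ∫ x, logDensity a u v x * (Real.exp x / (Real.exp x + Real.exp c)) =
      u / (u + v * Real.exp (a * c)) := by
  have hpi := Real.pi_pos
  set U : Set ℂ := {z | |z.im| < Real.pi / a} with hU
  have hUo : IsOpen U := isOpen_lt (continuous_im.abs) continuous_const
  have hcU : U ∈ 𝓝 (c : ℂ) := 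
    hUo.mem_nhds (by simp only [hU, mem_ofPred_eq, ofReal_im, abs_zero]; positivity)
  set g := stripFun a u v with hg
  -- The quotient of divided differences displays the removable singularity at `c`.
  set H : ℂ → ℂ := fun z => dslope g c z * exp z / dslope exp (c : ℂ) z with hH
  have hHne : ∀ z : ℂ, z ≠ c → H z = (g z - g c) * (exp z / (exp z - exp c)) := by
    intro z hz
    have : z - c ≠ 0 := sub_ne_zero.2 hz
    simp only [hH, dslope_of_ne _ hz, slope_def_field]
    field_simp
  have hd : DifferentiableOn ℂ H {z | |z.im| ≤ Real.pi} := by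
    refine DifferentiableOn.div (DifferentiableOn.mul ?_ differentiable_exp.differentiableOn) ?_ ?_
    · exact ((differentiableOn_dslope hcU).2 (differentiableOn_stripFun ha0 hu hv)).mono
        (strip_subset ha0 ha1)
    · exact ((differentiableOn_dslope univ_mem).2 differentiable_exp.differentiableOn).mono
        (subset_univ _)
    · intro z hz
      rw [mem_ofPred_eq] at hz
      exact dslope_exp_ne_zero c (by linarith)
  have hne_top : ∀ᶠ z : ℂ in comap re atTop, z ≠ c :=
    (tendsto_comap.eventually (eventually_gt_atTop c)).mono fun z hz h => by simp [h] at hz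
  have hne_bot : ∀ᶠ z : ℂ in comap re atBot, z ≠ c :=
    (tendsto_comap.eventually (eventually_lt_atBot c)).mono fun z hz h => by simp [h] at hz
  have hbot : Tendsto H (comap re atBot) (𝓝 0) := by
    have h1 : Tendsto (fun z : ℂ => exp z / (exp z - exp c)) (comap re atBot)
        (𝓝 (0 / (0 - exp c))) :=
      tendsto_exp_comap_re_atBot.div (tendsto_exp_comap_re_atBot.sub_const _)
        (by simp [exp_ne_zero])
    have h2 := ((stripFun_tendsto_atBot (v := v) ha0 hu).sub_const (g c)).mul h1
    rw [zero_div, mul_zero] at h2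
    exact h2.congr' (hne_bot.mono fun z hz => (hHne z hz).symm)
  have htop : Tendsto H (comap re atTop) (𝓝 (-g c)) := by
    have h1 : Tendsto (fun z : ℂ => exp z / (exp z - exp c)) (comap re atTop) (𝓝 1) := by
      have h3 : Tendsto (fun z : ℂ => 1 / (1 - exp c * (exp z)⁻¹)) (comap re atTop)
          (𝓝 (1 / (1 - exp c * 0))) :=
        tendsto_const_nhds.div ((((tendsto_inv₀_cobounded (α := ℂ)).comp
          tendsto_exp_comap_re_atTop).const_mul (exp (c : ℂ))).const_sub 1) (by simp)
      rw [mul_zero, sub_zero, div_one] at h3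
      refine h3.congr fun z => ?_
      have := exp_ne_zero z
      rw [← div_eq_mul_inv, one_sub_div this, one_div_div]
    have h2 := ((stripFun_tendsto_atTop (u := u) ha0 hv).sub_const (g c)).mul h1
    rw [zero_sub, mul_one] at h2
    exact h2.congr' (hne_top.mono fun z hz => (hHne z hz).symm)
  refine integral_of_jump hd hbot htop (fun x => ?_) ?_ (fun x => ?_) ?_
  · have n1 : (x : ℂ) - Real.pi * I ≠ c := fun h => by
      have := congrArg im h
      simp [hpi.ne'] at this
    have n2 : (x : ℂ) + Real.pi * I ≠ c := fun h => by
      have := congrArg im h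
      simp [hpi.ne'] at this
    have hj := stripFun_jump ha0 ha1 hu hv x
    have hs : (exp x + exp c : ℂ) ≠ 0 := by
      have : (Real.exp x + Real.exp c) ≠ 0 := by positivity
      exact_mod_cast this
    have hq : -exp (x : ℂ) / (-exp x - exp c) = exp x / (exp x + exp c) := by
      rw [← neg_div_neg_eq]; congr 1 <;> ring
    rw [hHne _ n1, hHne _ n2, exp_sub_pi_mul_I, exp_add_pi_mul_I, hq]
    push_cast
    linear_combination (exp x / (exp x + exp c)) * hj
  · simp only [hg, stripFun]
    push_cast
    ring
  · exact mul_nonneg (logDensity_nonneg ha0 ha1 hu hv x) (by positivity)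
  · refine (continuous_logDensity ha0 ha1 hu hv).mul (Continuous.div (by fun_prop) (by fun_prop)
      fun x => ?_)
    positivity

end Strip

/-! ### The limit law and its Stieltjes transform. -/

section Law

variable {a u v : ℝ}

/-- The odds `s / (1 - s)` of `s = sigmoid x` are `exp x`; extracting the powers of `1 - s` leaves a
function of `exp (a x)`. The prefactor is the Jacobian of the sigmoid. -/
lemma sigmoid_mul_occupationDensity (ha0 : 0 < a) (ha1 : a < 1) (hu : 0 < u) (hv : 0 < v) (x : ℝ) :
    Real.sigmoid x * (1 - Real.sigmoid x) * occupationDensity a u v (Real.sigmoid x) =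
      logDensity a u v x := by
  have hs0 := Real.sigmoid_pos x
  have hq0 : 0 < 1 - Real.sigmoid x := by linarith [Real.sigmoid_lt_one x]
  have hsq : Real.sigmoid x = (1 - Real.sigmoid x) * Real.exp x := by
    rw [Real.sigmoid_def, Real.exp_neg]
    have := Real.exp_pos x
    field_simp
    ring
  unfold occupationDensity logDensity
  set q := 1 - Real.sigmoid x with hq
  set s := Real.sigmoid x
  have hsa : s ^ a = q ^ a * Real.exp (a * x) := by
    rw [hsq, Real.mul_rpow hq0.le (Real.exp_pos x).le, ← Real.exp_mul, mul_comm x a]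
  have h2 : ∀ y : ℝ, 0 < y → y ^ (2 * a) = (y ^ a) ^ 2 := fun y hy => by
    rw [mul_comm, Real.rpow_mul hy.le, Real.rpow_two]
  have hqa : 0 < q ^ a := Real.rpow_pos_of_pos hq0 a
  rw [Real.rpow_sub_one hq0.ne', Real.rpow_sub_one hs0.ne', h2 s hs0, h2 q hq0, hsa]
  have hD := (logDensity_denom_pos ha0 ha1 hv hu (Real.exp_pos (a * x))).ne'
  set E := Real.exp (a * x)
  have h3 : v ^ 2 * (q ^ a * E) ^ 2 + u ^ 2 * (q ^ a) ^ 2 +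
      2 * u * v * Real.cos (a * Real.pi) * (q ^ a * E) * q ^ a =
      (q ^ a) ^ 2 * (v ^ 2 * E ^ 2 + u ^ 2 + 2 * u * v * Real.cos (a * Real.pi) * E) := by ring
  rw [h3]
  field_simp

lemma occupationDensity_nonneg (ha0 : 0 < a) (ha1 : a < 1) (hu : 0 < u) (hv : 0 < v) {x : ℝ}
    (hx : x ∈ Ioo (0 : ℝ) 1) : 0 ≤ occupationDensity a u v x := by
  obtain ⟨y, rfl⟩ : x ∈ range Real.sigmoid := by rwa [Real.range_sigmoid]
  have h1 := logDensity_nonneg ha0 ha1 hu hv y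
  rw [← sigmoid_mul_occupationDensity ha0 ha1 hu hv] at h1
  exact nonneg_of_mul_nonneg_right h1 (mul_pos hx.1 (by linarith [hx.2]))

lemma measurable_occupationDensity : Measurable (occupationDensity a u v) := by
  unfold occupationDensity
  fun_prop

lemma occupationLaw_image (ha0 : 0 < a) (ha1 : a < 1) (hu : 0 < u) (hv : 0 < v) (g : ℝ → ℝ) :
    (IntegrableOn (fun x => occupationDensity a u v x * g x) (Ioo 0 1) ↔
      Integrable fun x => logDensity a u v x * g (Real.sigmoid x)) ∧
    ∫ x in Ioo 0 1, occupationDensity a u v x * g x =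
      ∫ x, logDensity a u v x * g (Real.sigmoid x) := by
  have himg : Real.sigmoid '' univ = Ioo 0 1 := by rw [image_univ, Real.range_sigmoid]
  have hder : ∀ x ∈ (univ : Set ℝ), HasDerivWithinAt Real.sigmoid
      (Real.sigmoid x * (1 - Real.sigmoid x)) univ x := fun x _ =>
    (Real.hasDerivAt_sigmoid x).hasDerivWithinAt
  have hfun : (fun x => |Real.sigmoid x * (1 - Real.sigmoid x)| •
      (occupationDensity a u v (Real.sigmoid x) * g (Real.sigmoid x))) =
      fun x => logDensity a u v x * g (Real.sigmoid x) := by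
    funext x
    rw [abs_of_nonneg (mul_nonneg (Real.sigmoid_nonneg x)
      (by linarith [Real.sigmoid_lt_one x])), smul_eq_mul, ← mul_assoc,
      sigmoid_mul_occupationDensity ha0 ha1 hu hv]
  constructor
  · rw [← himg, integrableOn_image_iff_integrableOn_abs_deriv_smul MeasurableSet.univ hder
      Real.sigmoid_injective.injOn, hfun, integrableOn_univ]
  · rw [← himg, integral_image_eq_integral_abs_deriv_smul MeasurableSet.univ hder
      Real.sigmoid_injective.injOn, hfun, setIntegral_univ]

lemma isProbabilityMeasure_occupationLaw (ha0 : 0 < a) (ha1 : a < 1) (hu : 0 < u) (hv : 0 < v) :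
    IsProbabilityMeasure (occupationLaw a u v) := by
  have h := occupationLaw_image ha0 ha1 hu hv fun _ => 1
  have hk := integral_logDensity ha0 ha1 hu hv
  simp only [mul_one] at h
  rw [hk.2] at h
  constructor
  rw [occupationLaw, withDensity_apply _ MeasurableSet.univ, Measure.restrict_univ,
    ← ofReal_integral_eq_lintegral_ofReal (h.1.2 hk.1), h.2, ENNReal.ofReal_one]
  filter_upwards [ae_restrict_mem measurableSet_Ioo] with x hx
  exact occupationDensity_nonneg ha0 ha1 hu hv hx

lemma ae_occupationLaw_mem : ∀ᵐ x ∂(occupationLaw a u v), x ∈ Icc (0 : ℝ) 1 :=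
  (withDensity_absolutelyContinuous _ _).ae_le
    ((ae_restrict_mem measurableSet_Ioo).mono fun _ hx => Ioo_subset_Icc_self hx)

lemma integral_occupationLaw (ha0 : 0 < a) (ha1 : a < 1) (hu : 0 < u) (hv : 0 < v) (g : ℝ → ℝ) :
    ∫ x, g x ∂(occupationLaw a u v) = ∫ x, logDensity a u v x * g (Real.sigmoid x) := by
  rw [← (occupationLaw_image ha0 ha1 hu hv g).2, occupationLaw,
    integral_withDensity_eq_integral_toReal_smul measurable_occupationDensity.ennreal_ofReal
      (ae_of_all _ fun _ => ENNReal.ofReal_lt_top)]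
  refine setIntegral_congr_fun measurableSet_Ioo fun x hx => ?_
  simp only [smul_eq_mul]
  rw [ENNReal.toReal_ofReal (occupationDensity_nonneg ha0 ha1 hu hv hx)]

/-- The Stieltjes transform of the limit law. -/
lemma integral_inv_occupationLaw (ha0 : 0 < a) (ha1 : a < 1) (hu : 0 < u) (hv : 0 < v) {c l : ℝ}
    (hc : 0 < c) (hl : 0 ≤ l) :
    ∫ x, 1 / (c + l * x) ∂(occupationLaw a u v) =
      (u * (c + l) ^ a / (c + l) + v * c ^ a / c) / (u * (c + l) ^ a + v * c ^ a) := by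
  have hK : 0 < c + l := by linarith
  have hq : Real.exp (Real.log (c / (c + l))) = c / (c + l) := Real.exp_log (by positivity)
  have hqa : Real.exp (a * Real.log (c / (c + l))) = c ^ a / (c + l) ^ a := by
    rw [mul_comm, Real.exp_mul, hq, Real.div_rpow hc.le hK.le]
  have h1 := integral_logDensity ha0 ha1 hu hv
  have h2 := integral_logDensity_mul ha0 ha1 hu hv (Real.log (c / (c + l)))
  rw [hq, hqa] at h2
  -- Partial fractions in `exp x`: the kernel becomes a constant minus a multiple of the one in
  -- `integral_logDensity_mul`, with `exp c` there equal to `c / (c + l)` here.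
  have h3 : ∀ x, logDensity a u v x * (1 / (c + l * Real.sigmoid x)) =
      1 / c * logDensity a u v x - l / (c * (c + l)) *
        (logDensity a u v x * (Real.exp x / (Real.exp x + c / (c + l)))) := by
    intro x
    have hE := Real.exp_pos x
    have hd : 0 < c * (1 + Real.exp x) + l * Real.exp x := by positivity
    have hd' : 0 < Real.exp x * (c + l) + c := by positivity
    have hs : Real.sigmoid x = Real.exp x / (1 + Real.exp x) := by
      rw [Real.sigmoid_def, Real.exp_neg]
      field_simp
      ring
    have h4 : 1 / (c + l * Real.sigmoid x) =
        1 / c - l / (c * (c + l)) * (Real.exp x / (Real.exp x + c / (c + l))) := by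
      rw [hs]
      field_simp
      ring
    rw [h4]
    ring
  rw [integral_occupationLaw ha0 ha1 hu hv]
  simp_rw [h3]
  rw [integral_sub (h1.1.const_mul _) (h2.1.const_mul _), integral_const_mul, integral_const_mul,
    h1.2, h2.2]
  have hca : 0 < c ^ a := Real.rpow_pos_of_pos hc a
  have hKa : 0 < (c + l) ^ a := Real.rpow_pos_of_pos hK a
  field_simp
  ring

/-- The cosine vanishes at `π / 2`, and `x + (1 - x) = 1` reduces the denominator to `u ^ 2`. -/
lemma occupationLaw_half_eq_arcsineLaw (hu : 0 < u) : occupationLaw (1 / 2) u u = arcsineLaw := by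
  refine withDensity_congr_ae ?_
  filter_upwards [ae_restrict_mem measurableSet_Ioo] with x hx
  have hx0 : 0 < x := hx.1
  have hx1 : 0 < 1 - x := by linarith [hx.2]
  congr 1
  unfold occupationDensity
  rw [show (1 / 2 : ℝ) * Real.pi = Real.pi / 2 by ring, Real.cos_pi_div_two,
    show Real.pi * (1 / 2) = Real.pi / 2 by ring, Real.sin_pi_div_two,
    show (2 : ℝ) * (1 / 2) = 1 by norm_num, Real.rpow_one, Real.rpow_one,
    Real.rpow_sub_one hx0.ne', Real.rpow_sub_one hx1.ne', ← Real.sqrt_eq_rpow, ← Real.sqrt_eq_rpow,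
    Real.sqrt_mul hx0.le]
  have hs0 := Real.sqrt_pos.2 hx0
  have hs1 := Real.sqrt_pos.2 hx1
  have h0 := Real.sq_sqrt hx0.le
  have h1 := Real.sq_sqrt hx1.le
  have hpi := Real.pi_pos
  have hden : u ^ 2 * x + u ^ 2 * (1 - x) + 2 * u * u * 0 * √x * √(1 - x) = u ^ 2 := by ring
  rw [hden]
  field_simp
  rw [h0, h1, mul_comm]

end Law

/-! ### Asymptotics of the rescaled Laplace transforms. -/

section Limit

variable {N : ℕ} {Ω : Type*} [MeasurableSpace Ω] {P : Measure Ω}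
  [IsProbabilityMeasure P] {M : Matrix (Fin N) (Fin N) ℝ} {ε p α B : Fin N → ℝ}
  {φ : Fin N → Measure ℝ} {J : ℕ → Ω → Fin N} {T : ℕ → Ω → ℝ}

/-- The limit of the Laplace transforms of the occupation time under scaling; only the states with
the smallest exponent `a` contribute. -/
lemma tendsto_laplace_occupationTime (hM : M ∈ Matrix.rowStochastic ℝ (Fin N))
    (hirr : M.IsIrreducible) (hε : ε ∈ stdSimplex ℝ (Fin N)) (heq : Matrix.vecMul ε M = ε)
    (hp : p ∈ stdSimplex ℝ (Fin N)) (hα : ∀ i, 0 < α i) (hB : ∀ i, 0 < B i)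
    (hφ : ∀ i, IsPowerLawWaitingTime (φ i) (α i) (B i)) (hJT : IsMultiStateRenewal P p M φ J T)
    {a : ℝ} (ha : ∀ i, a ≤ α i) (ha' : ∃ i, α i = a) (i₀ : Fin N) {c l : ℝ} (hc : 0 < c)
    (hl : 0 ≤ l) {κ b : Fin N → ℝ} (hκ : ∀ i, κ i = c + l * if i = i₀ then 1 else 0)
    (hb : ∀ i, b i = if α i = a then B i * κ i ^ a else 0) :
    Tendsto (fun r : ℝ => ∫ ω, (∫ t in Ioi 0,
        Real.exp (-(c * t + l * (occupationTime J T i₀ (r * t) ω / r)))) ∂P) atTop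
      (𝓝 ((∑ i, ε i * b i / κ i) / ∑ i, ε i * b i)) := by
  have hprob := fun i => (hφ i).isProbabilityMeasure
  have h0 := fun i => (hφ i).positive
  have hcκ : ∀ i, c ≤ κ i := fun i => by
    rw [hκ]; split_ifs <;> simp [hl]
  have hκ0 : ∀ i, 0 < κ i := fun i => hc.trans_le (hcκ i)
  set δ : ℝ → Fin N → ℝ := fun r i => 1 - ∫ τ, Real.exp (-(κ i / r * τ)) ∂(φ i) with hδ
  have hex : ∀ r : ℝ, ∃ y : Fin N → ℝ, 0 < r → (∀ i, 0 ≤ y i ∧ y i ≤ 1 / c) ∧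
      (∀ i, y i = δ r i / κ i + (1 - δ r i) * M.mulVec y i) ∧
      ∫ ω, (∫ t in Ioi 0,
        Real.exp (-(c * t + l * (occupationTime J T i₀ (r * t) ω / r)))) ∂P = ∑ i, p i * y i := by
    intro r
    by_cases hr : 0 < r
    -- The substitution `t ↦ r t` corresponds to the parameters `c / r` and `l / r`, and its
    -- Jacobian rescales the solution by `r⁻¹`.
    · obtain ⟨y, hy1, hy2, hy3⟩ := hJT.exists_laplace hp hM h0 i₀ (s := c / r) (u := l / r)
        (by positivity) (by positivity) (fun i => κ i / r) (fun i => 1 - δ r i)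
        (fun i => by rw [hκ]; ring) (fun i => by simp [hδ])
      refine ⟨fun i => r⁻¹ * y i, fun _ => ⟨fun i => ⟨mul_nonneg (by positivity) (hy1 i).1, ?_⟩,
        fun i => ?_, ?_⟩⟩
      · calc r⁻¹ * y i ≤ r⁻¹ * (1 / (c / r)) :=
              mul_le_mul_of_nonneg_left (hy1 i).2 (by positivity)
          _ = 1 / c := by field_simp
      · have h1 : M.mulVec (fun i => r⁻¹ * y i) i = r⁻¹ * M.mulVec y i := by
          have := congrFun (Matrix.mulVec_smul M r⁻¹ y) i
          simpa [Pi.smul_def] using this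
        rw [h1]
        dsimp only
        nth_rewrite 1 [hy2 i]
        have := hκ0 i
        field_simp
        ring
      · have h1 : ∀ ω, ∫ t in Ioi 0,
            Real.exp (-(c * t + l * (occupationTime J T i₀ (r * t) ω / r))) =
            r⁻¹ * ∫ t in Ioi 0, Real.exp (-(c / r * t + l / r * occupationTime J T i₀ t ω)) := by
          intro ω
          have h2 := integral_comp_mul_left_Ioi
            (fun t => Real.exp (-(c / r * t + l / r * occupationTime J T i₀ t ω))) 0 hr
          rw [mul_zero, smul_eq_mul] at h2
          rw [← h2]
          refine setIntegral_congr_fun measurableSet_Ioi fun t _ => ?_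
          congr 2
          field_simp
        simp_rw [h1]
        rw [integral_const_mul, hy3, Finset.mul_sum]
        exact Finset.sum_congr rfl fun i _ => by ring
    · exact ⟨0, fun h => absurd h hr⟩
  choose y hy using hex
  have hκr : ∀ i, Tendsto (fun r : ℝ => κ i / r) atTop (𝓝[>] 0) := fun i =>
    tendsto_nhdsWithin_iff.2 ⟨tendsto_const_nhds.div_atTop tendsto_id,
      (eventually_gt_atTop 0).mono fun r hr => div_pos (hκ0 i) hr⟩
  have hlap : ∀ i, Tendsto (fun r : ℝ => δ r i / (κ i / r) ^ α i) atTop (𝓝 (B i)) := fun i =>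
    (hφ i).laplace.comp (hκr i)
  have hpow0 : ∀ i (e : ℝ), 0 < e → Tendsto (fun r : ℝ => (κ i / r) ^ e) atTop (𝓝 0) := by
    intro i e he
    have h1 := ((Real.continuousAt_rpow_const 0 e (Or.inr he.le)).tendsto.mono_left
      nhdsWithin_le_nhds).comp (hκr i)
    rwa [Real.zero_rpow he.ne'] at h1
  have hfac : ∀ i, ∀ᶠ r : ℝ in atTop, δ r i = (κ i / r) ^ α i * (δ r i / (κ i / r) ^ α i) :=
    fun i => (eventually_gt_atTop 0).mono fun r hr => by
      have := Real.rpow_pos_of_pos (div_pos (hκ0 i) hr) (α i)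
      field_simp
  have hδ0 : ∀ i, Tendsto (fun r => δ r i) atTop (𝓝 0) := fun i => by
    have h1 := (hpow0 i (α i) (hα i)).mul (hlap i)
    rw [zero_mul] at h1
    exact h1.congr' ((hfac i).mono fun r hr => hr.symm)
  -- `r ^ a δ i` is `κ i ^ a (κ i / r) ^ (α i - a)` times a ratio tending to `B i`, so exponents
  -- above `a` drop out.
  have hwδ : ∀ i, Tendsto (fun r : ℝ => r ^ a * δ r i) atTop (𝓝 (b i)) := by
    intro i
    have h1 : Tendsto (fun r : ℝ => κ i ^ a * (κ i / r) ^ (α i - a)) atTop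
        (𝓝 (if α i = a then κ i ^ a else 0)) := by
      split_ifs with h
      · simp [h]
      · have h2 := (hpow0 i (α i - a) (sub_pos.2 (lt_of_le_of_ne (ha i) (Ne.symm h)))).const_mul
          (κ i ^ a)
        rwa [mul_zero] at h2
    have h2 := h1.mul (hlap i)
    have h3 : (if α i = a then κ i ^ a else 0) * B i = b i := by
      rw [hb]; split_ifs <;> ring
    rw [h3] at h2
    refine h2.congr' ?_
    filter_upwards [hfac i, eventually_gt_atTop 0] with r hr hr0
    have hκr0 := div_pos (hκ0 i) hr0
    nth_rewrite 2 [hr]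
    rw [Real.rpow_sub hκr0, Real.div_rpow (hκ0 i).le hr0.le (z := a)]
    have := Real.rpow_pos_of_pos (hκ0 i) a
    have := Real.rpow_pos_of_pos hr0 a
    have := Real.rpow_pos_of_pos hκr0 (α i)
    field_simp
  have hεpos := equilibrium_pos hirr hε heq
  have hb0 : ∑ i, ε i * b i ≠ 0 := by
    obtain ⟨j, hj⟩ := ha'
    refine (Finset.sum_pos' (fun i _ => mul_nonneg (hεpos i).le ?_)
      ⟨j, Finset.mem_univ j, mul_pos (hεpos j) ?_⟩).ne'
    · rw [hb]
      have := Real.rpow_pos_of_pos (hκ0 i) a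
      have := hB i
      split_ifs <;> positivity
    · rw [hb, if_pos hj]
      exact mul_pos (hB j) (Real.rpow_pos_of_pos (hκ0 j) a)
  have hlim := tendsto_of_perturbed_harmonic hM hirr heq hδ0 hwδ hb0
    ((eventually_gt_atTop 0).mono fun r hr => (hy r hr).1)
    ((eventually_gt_atTop 0).mono fun r hr => (hy r hr).2.1)
  have h1 : Tendsto (fun r => ∑ i, p i * y r i) atTop
      (𝓝 (∑ i, p i * ((∑ i, ε i * b i / κ i) / ∑ i, ε i * b i))) :=
    tendsto_finsetSum _ fun i _ => (tendsto_pi_nhds.1 hlim i).const_mul _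
  rw [← Finset.sum_mul, hp.2, one_mul] at h1
  exact h1.congr' ((eventually_gt_atTop 0).mono fun r hr => (hy r hr).2.2.symm)

/-- Convergence in law of the fraction of time spent in a state, reduced to the identification
of a Stieltjes transform. -/
lemma convergesInLaw_occupationTime (hM : M ∈ Matrix.rowStochastic ℝ (Fin N))
    (hirr : M.IsIrreducible) (hε : ε ∈ stdSimplex ℝ (Fin N)) (heq : Matrix.vecMul ε M = ε)
    (hp : p ∈ stdSimplex ℝ (Fin N)) (hα : ∀ i, 0 < α i) (hB : ∀ i, 0 < B i)
    (hφ : ∀ i, IsPowerLawWaitingTime (φ i) (α i) (B i)) (hJT : IsMultiStateRenewal P p M φ J T)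
    {a : ℝ} (ha : ∀ i, a ≤ α i) (ha' : ∃ i, α i = a) (i₀ : Fin N)
    {ν : Measure ℝ} [IsProbabilityMeasure ν] (hν : ∀ᵐ x ∂ν, x ∈ Icc (0 : ℝ) 1)
    (hS : ∀ (c l : ℝ) (κ b : Fin N → ℝ), 0 < c → 0 ≤ l →
      (∀ i, κ i = c + l * if i = i₀ then 1 else 0) →
      (∀ i, b i = if α i = a then B i * κ i ^ a else 0) →
      ∫ x, 1 / (c + l * x) ∂ν = (∑ i, ε i * b i / κ i) / ∑ i, ε i * b i) :
    ConvergesInLaw (fun t ω => occupationTime J T i₀ t ω / t) P ν := by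
  refine convergesInLaw_of_laplace
    (measurable_occupationTime hJT.measurable_state hJT.measurable_wait i₀)
    (fun ω => by simp [occupationTime, stateFunctional])
    (fun ω s t h => occupationTime_sub_mem hJT.measurable_state hJT.measurable_wait i₀ ω h)
    hν fun m n => ?_
  have hc : (0 : ℝ) < 1 + m := by positivity
  rw [hS (1 + m) n _ _ hc (Nat.cast_nonneg n) (fun _ => rfl) (fun _ => rfl)]
  exact tendsto_laplace_occupationTime hM hirr hε heq hp hα hB hφ hJT ha ha' i₀ hc
    (Nat.cast_nonneg n) (fun _ => rfl) (fun _ => rfl)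

end Limit

end MultiState

/-! ### The three regimes. -/

theorem mainTheorem6 {N : ℕ} [NeZero N] {Ω : Type*} [MeasurableSpace Ω]
    (P : Measure Ω) [IsProbabilityMeasure P]
    (M : Matrix (Fin N) (Fin N) ℝ) (hM : M ∈ Matrix.rowStochastic ℝ (Fin N))
    (hirr : M.IsIrreducible)
    (ε : Fin N → ℝ) (hε : ε ∈ stdSimplex ℝ (Fin N)) (heq : Matrix.vecMul ε M = ε)
    (p : Fin N → ℝ) (hp : p ∈ stdSimplex ℝ (Fin N))
    (α B : Fin N → ℝ) (hα : ∀ i, 0 < α i ∧ α i < 1) (hB : ∀ i, 0 < B i)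
    (φ : Fin N → Measure ℝ)
    (hφ : ∀ i, MultiState.IsPowerLawWaitingTime (φ i) (α i) (B i))
    (J : ℕ → Ω → Fin N) (T : ℕ → Ω → ℝ)
    (hJT : MultiState.IsMultiStateRenewal P p M φ J T) :
    ((∀ j, j ≠ 0 → α 0 < α j) →
      MultiState.ConvergesInLaw (fun t ω => MultiState.occupationTime J T 0 t ω / t) P
        (Measure.dirac 1)) ∧
    ((∃ j, α j < α 0) →
      MultiState.ConvergesInLaw (fun t ω => MultiState.occupationTime J T 0 t ω / t) P
        (Measure.dirac 0)) ∧
    (∀ (m : ℕ) (a b : ℝ), 2 ≤ m → m ≤ N →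
      (∀ i : Fin N, i.val < m → α i = a ∧ B i = b) →
      (∀ i : Fin N, m ≤ i.val → a < α i) →
      MultiState.ConvergesInLaw (fun t ω => MultiState.occupationTime J T 0 t ω / t) P
        (MultiState.occupationLaw a (ε 0)
          (∑ i : Fin N with 0 < i.val ∧ i.val < m, ε i)) ∧
      (a = 1 / 2 → ε 0 = ∑ i : Fin N with 0 < i.val ∧ i.val < m, ε i →
        MultiState.occupationLaw a (ε 0)
            (∑ i : Fin N with 0 < i.val ∧ i.val < m, ε i) =
          MultiState.arcsineLaw)) := by
  have hα0 : ∀ i, 0 < α i := fun i => (hα i).1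
  have hεpos := MultiState.equilibrium_pos hirr hε heq
  refine ⟨fun h1 => ?_, fun ⟨j, hj⟩ => ?_, fun m a b hm hmN hlt hge => ?_⟩
  · refine MultiState.convergesInLaw_occupationTime hM hirr hε heq hp hα0 hB hφ hJT (a := α 0)
      (fun i => ?_) ⟨0, rfl⟩ 0 ?_ fun c l κ b hc hl hκ hb => ?_
    · by_cases hi : i = 0
      · rw [hi]
      · exact (h1 i hi).le
    · rw [ae_dirac_eq]
      exact ⟨zero_le_one, le_rfl⟩
    -- State `0` alone has the minimal exponent, so the average reduces to `1 / κ 0 = 1 / (c + l)`.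
    · have hb0 : ∀ i, i ≠ 0 → b i = 0 := fun i hi => by rw [hb, if_neg (h1 i hi).ne']
      rw [integral_dirac, Finset.sum_eq_single 0 (fun i _ hi => by simp [hb0 i hi]) (by simp),
        Finset.sum_eq_single 0 (fun i _ hi => by simp [hb0 i hi]) (by simp)]
      have hκ0 : κ 0 = c + l := by simp [hκ]
      have hK : 0 < c + l := by linarith
      have h2 : 0 < b 0 := by
        rw [hb, if_pos rfl, hκ0]
        exact mul_pos (hB 0) (Real.rpow_pos_of_pos hK _)
      have := hεpos 0
      rw [hκ0]
      field_simp
  · obtain ⟨k, hk⟩ := Finite.exists_min α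
    have hb0' : α 0 ≠ α k := ((hk j).trans_lt hj).ne'
    refine MultiState.convergesInLaw_occupationTime hM hirr hε heq hp hα0 hB hφ hJT hk
      ⟨k, rfl⟩ 0 ?_ fun c l κ b hc hl hκ hb => ?_
    · rw [ae_dirac_eq]
      exact ⟨le_rfl, zero_le_one⟩
    -- State `0` has weight `0`, and every other state has `κ i = c`; the average is `1 / c`.
    · have hκi : ∀ i, ε i * b i / κ i = ε i * b i / c := fun i => by
        by_cases hi : i = 0
        · rw [hb, hi, if_neg hb0']; simp
        · rw [hκ, if_neg hi]; simp
      have hκ0 : ∀ i, 0 < κ i := fun i => by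
        rw [hκ]; split_ifs <;> simp <;> linarith
      have hpos : 0 < ∑ i, ε i * b i := by
        refine Finset.sum_pos' (fun i _ => mul_nonneg (hεpos i).le ?_)
          ⟨k, Finset.mem_univ k, mul_pos (hεpos k) ?_⟩
        · rw [hb]
          have := Real.rpow_pos_of_pos (hκ0 i) (α k)
          have := hB i
          split_ifs <;> positivity
        · rw [hb, if_pos rfl]
          exact mul_pos (hB k) (Real.rpow_pos_of_pos (hκ0 k) _)
      simp_rw [hκi]
      rw [integral_dirac, ← Finset.sum_div]
      field_simp
      simp
  · have hval0 : (0 : Fin N).val < m := by simp; omega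
    have ha0 : α 0 = a := (hlt 0 hval0).1
    have hapos : 0 < a := ha0 ▸ hα0 0
    have ha1 : a < 1 := ha0 ▸ (hα 0).2
    have hbpos : 0 < b := (hlt 0 hval0).2 ▸ hB 0
    set v := ∑ i : Fin N with 0 < i.val ∧ i.val < m, ε i with hv
    have hvpos : 0 < v := by
      refine Finset.sum_pos (fun i _ => hεpos i) ⟨⟨1, by omega⟩, ?_⟩
      exact Finset.mem_filter.2 ⟨Finset.mem_univ _, Nat.one_pos, hm⟩
    refine ⟨?_, fun ha hu => ?_⟩
    · have := MultiState.isProbabilityMeasure_occupationLaw hapos ha1 (hεpos 0) hvpos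
      refine MultiState.convergesInLaw_occupationTime hM hirr hε heq hp hα0 hB hφ hJT (a := a)
        (fun i => ?_) ⟨0, ha0⟩ 0 MultiState.ae_occupationLaw_mem fun c l κ β hc hl hκ hβ => ?_
      · rcases lt_or_ge i.val m with hi | hi
        · exact (hlt i hi).1.ge
        · exact (hge i hi).le
      -- Numerator and denominator are the cases `g = 1 / x` and `g = 1`. The common constant `b`
      -- factors out of both and cancels.
      · have hsum : ∀ g : ℝ → ℝ, ∑ i, ε i * β i * g (κ i) =
            b * (ε 0 * (c + l) ^ a * g (c + l) + v * c ^ a * g c) := by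
          intro g
          have h1 : ∀ i ∈ Finset.univ.erase (0 : Fin N), ε i * β i * g (κ i) =
              if 0 < i.val ∧ i.val < m then b * (ε i * (c ^ a * g c)) else 0 := by
            intro i hi
            have hi0 : i ≠ 0 := Finset.ne_of_mem_erase hi
            have hi1 : 0 < i.val := Nat.pos_of_ne_zero fun h => hi0 (Fin.ext (by simpa using h))
            have hκi : κ i = c := by rw [hκ, if_neg hi0]; ring
            rcases lt_or_ge i.val m with him | him
            · rw [if_pos ⟨hi1, him⟩, hβ, if_pos (hlt i him).1, (hlt i him).2, hκi]
              ring
            · rw [if_neg (fun h => absurd h.2 (not_lt.2 him)), hβ, if_neg (hge i him).ne']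
              ring
          have h2 : ∑ i ∈ Finset.univ.erase (0 : Fin N),
              (if 0 < i.val ∧ i.val < m then b * (ε i * (c ^ a * g c)) else 0) =
              b * (v * (c ^ a * g c)) := by
            rw [Finset.sum_erase _ (by simp), ← Finset.sum_filter, ← Finset.mul_sum,
              ← Finset.sum_mul]
          rw [← Finset.add_sum_erase _ _ (Finset.mem_univ (0 : Fin N)), Finset.sum_congr rfl h1,
            h2, hβ, if_pos ha0, (hlt 0 hval0).2, hκ, if_pos rfl, mul_one]
          ring
        have hs1 := hsum fun x => 1 / x
        have hs2 := hsum fun _ => 1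
        simp only [mul_one, mul_one_div] at hs1 hs2
        rw [MultiState.integral_inv_occupationLaw hapos ha1 (hεpos 0) hvpos hc hl, hs1, hs2,
          mul_div_mul_left _ _ hbpos.ne']
    · rw [ha, ← hu]
      exact MultiState.occupationLaw_half_eq_arcsineLaw (hεpos 0)
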